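/- Consider a single-cell cellular network with D2D (device-to-device) links underlaid. The cell $\mathcal C$ is the disk of radius $R_C>0$ around the base station (the origin of $\mathbb R^2$). The D2D transmitters $x_0,x_1,\dots$ form a homogeneous Poisson point process of density $\lambda>0$ in $\mathbb R^2$. The receiver of link $k$ is $y_k=x_k+o_k$ with $o_k$ uniform in the disk of radius $R_D>0$ around $0$, and its transmit power is $p_k>0$; the pairs $(o_k,p_k)$ are i.i.d. (within a pair, dependence is allowed). The $M$ cellular users $c_1,\dots,c_M$ are uniformly distributed in $\mathcal C$ and transmit with a random power $p_0\ge 0$. Each link $k$ carries a random mark $Q_k\in\{1,\dots,M\}$, i.i.d. over $k$ (independent thinning), and shares the resource of the cellular user $c_{Q_k}$. The channel gains $h_{k,i}$ (from D2D transmitter $i$ to D2D receiver $k$) and $h_{k,c_m}$ (from $c_m$ to D2D receiver $k$) are Rayleigh fading: $|h|^2\sim\exp(1)$. The point process, the pairs $(o_k,p_k)$, the marks, the cellular users' positions, $p_0$ and all the channel gains are mutually independent. The path-loss exponent is $\alpha>2$, the noise power is $\sigma^2\ge 0$, and $\mathbb E[p_k^{2/\alpha}]<\infty$. Write $d_{k,i}=\|y_k-x_i\|$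 and $d_{k,c_m}=\|y_k-c_m\|$. Fix $m$ with $\mathbb P[Q_k=m]>0$ and let $\Phi'$ be the set of links $k$ with $Q_k=m$. For $k\in\Phi'$ put $$\mathrm{SINR}_k=\frac{p_k|h_{k,k}|^2d_{k,k}^{-\alpha}}{\sum_{i\in\Phi',\,i\ne k}p_i|h_{k,i}|^2d_{k,i}^{-\alpha}+p_0|h_{k,c_m}|^2d_{k,c_m}^{-\alpha}+\sigma^2}.$$ For a threshold $\beta_k=\beta>0$ let the D2D coverage probability $\mathcal P_{\mathrm{cov},D}(\beta_k)$ be the probability that $\mathrm{SINR}_k\ge\beta_k$ for the typical link of $\Phi'$ with receiver in $\mathcal C$ (Palm probability), that is $$\mathcal P_{\mathrm{cov},D}(\beta)=\frac{\mathbb E\,\#\{k\in\Phi':\ y_k\in\mathcal C,\ \mathrm{SINR}_k\ge\beta\}}{\mathbb E\,\#\{k\in\Phi':\ y_k\in\mathcal C\}},$$ where the denominator is positive and finite. Then $$\mathcal P_{\mathrm{cov},D}(\beta_k)=\mathbb E_Z\Big[e^{-\beta_k\sigma^2Z-\theta_kZ^{2/\alpha}}\,\mathcal L_Y(\beta_kZ)\Big],\qquad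 \theta_k=\frac{\pi\,\mathbb P[Q_k=m]\,\lambda\,\beta_k^{2/\alpha}}{\operatorname{sinc}(2/\alpha)}\,\mathbb E[p_k^{2/\alpha}],$$ with $\operatorname{sinc}(x)=\frac{\sin \pi x}{\pi x}$, $Z=d_{k,k}^{\alpha}p_k^{-1}$, $Y=|h_{k,c_m}|^2d_{k,c_m}^{-\alpha}p_0$ and $\mathcal L_Y(s)=\mathbb E[e^{-sY}]$, where in $Y$ the three factors are independent and $d_{k,c_m}$ is the distance between two independent uniformly distributed points of $\mathcal C$. If moreover $d_{k,k}$ and $p_k$ are independent, then $Z$ has the cdf $F_Z(z)=\int F_{d_{k,k}}(z^{1/\alpha}p^{1/\alpha})\,dF_{p_k}(p)$, $z\ge 0$. -/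

import Mathlib

open MeasureTheory ProbabilityTheory
open scoped ENNReal NNReal

/-- `Φ : Ω → Measure S` is a Poisson point process with intensity measure `Λ`: the number of
points in a measurable set of finite intensity is Poisson distributed, and the numbers of points
in finitely many pairwise disjoint measurable sets are independent. -/
structure IsPoissonPointProcess {Ω S : Type*} [MeasurableSpace Ω] [MeasurableSpace S]
    (P : Measure Ω) (Λ : Measure S) (Φ : Ω → Measure S) : Prop where
  measurable_count : ∀ A : Set S, MeasurableSet A → Measurable fun ω => Φ ω A
  poisson_count : ∀ A : Set S, MeasurableSet A → Λ A ≠ ∞ →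
    P.map (fun ω => Φ ω A) = (poissonMeasure (Λ A).toNNReal).map (fun n : ℕ => (n : ℝ≥0∞))
  indep_count : ∀ (n : ℕ) (A : Fin n → Set S), (∀ i, MeasurableSet (A i)) →
    Pairwise (fun i j => Disjoint (A i) (A j)) → iIndepFun (fun i ω => Φ ω (A i)) P

/-- The Euclidean plane. -/
abbrev Plane : Type := EuclideanSpace ℝ (Fin 2)

/-- The parameters and the random elements of a single-cell device-to-device (D2D) network
underlaying a cellular network with `M` cellular users; the base station is at the origin. The
D2D links are numbered by `k : ℕ`. -/
structure D2DNetwork (Ω : Type*) (M : ℕ) where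
  /-- density of the D2D transmitters -/
  lam : ℝ
  /-- radius of the cell -/
  RC : ℝ
  /-- maximal distance of a D2D receiver from its transmitter -/
  RD : ℝ
  /-- path-loss exponent -/
  α : ℝ
  /-- standard deviation of the noise (its power is `σ ^ 2`) -/
  σ : ℝ
  /-- position of the `k`-th D2D transmitter -/
  tx : ℕ → Ω → Plane
  /-- displacement of the `k`-th D2D receiver from its transmitter -/
  offset : ℕ → Ω → Plane
  /-- transmit power of the `k`-th D2D transmitter -/
  power : ℕ → Ω → ℝ
  /-- the mark of the `k`-th D2D link: the cellular user with which it shares its resource -/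
  label : ℕ → Ω → Fin M
  /-- position of the `m`-th cellular user -/
  cue : Fin M → Ω → Plane
  /-- transmit power of a cellular user -/
  cuePower : Ω → ℝ
  /-- `gain k l`: channel gain from the `l`-th D2D transmitter to the `k`-th D2D receiver -/
  gain : ℕ → ℕ → Ω → ℂ
  /-- `cueGain k m`: channel gain from the `m`-th cellular user to the `k`-th D2D receiver -/
  cueGain : ℕ → Fin M → Ω → ℂ

namespace D2DNetwork

variable {Ω : Type*} {M : ℕ}

/-- The sources of randomness of the network. -/
inductive Source (M : ℕ) : Type
  | positions
  | mark (k : ℕ)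
  | label (k : ℕ)
  | cue (m : Fin M)
  | cuePower
  | gain (k l : ℕ)
  | cueGain (k : ℕ) (m : Fin M)

/-- The information carried by each source of randomness. All transmitter positions together form
one source, and so do the displacement and the power of one link (a transmitter may choose its
power as a function of the distance to its receiver). -/
@[reducible] noncomputable def sigmaAlg (N : D2DNetwork Ω M) : Source M → MeasurableSpace Ω
  | .positions => ⨆ k, MeasurableSpace.comap (N.tx k) inferInstance
  | .mark k => MeasurableSpace.comap (fun ω => (N.offset k ω, N.power k ω)) inferInstance
  | .label k => MeasurableSpace.comap (N.label k) ⊤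
  | .cue m => MeasurableSpace.comap (N.cue m) inferInstance
  | .cuePower => MeasurableSpace.comap N.cuePower inferInstance
  | .gain k l => MeasurableSpace.comap (N.gain k l) inferInstance
  | .cueGain k m => MeasurableSpace.comap (N.cueGain k m) inferInstance

/-- The cell: the disk of radius `RC` around the base station. -/
def cell (N : D2DNetwork Ω M) : Set Plane := Metric.closedBall 0 N.RC

/-- Position of the `k`-th D2D receiver. -/
def rx (N : D2DNetwork Ω M) (k : ℕ) (ω : Ω) : Plane := N.tx k ω + N.offset k ω

/-- The distance `d_{k,k}` between transmitter and receiver of the `k`-th D2D link. -/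
noncomputable def linkDist (N : D2DNetwork Ω M) (k : ℕ) (ω : Ω) : ℝ := dist (N.rx k ω) (N.tx k ω)

/-- The distributional assumptions on the network. -/
structure IsModel [MeasurableSpace Ω] (N : D2DNetwork Ω M) (P : Measure Ω) : Prop where
  lam_pos : 0 < N.lam
  RC_pos : 0 < N.RC
  RD_pos : 0 < N.RD
  two_lt_α : 2 < N.α
  measurable_tx : ∀ k, Measurable (N.tx k)
  measurable_offset : ∀ k, Measurable (N.offset k)
  measurable_power : ∀ k, Measurable (N.power k)
  measurable_label : ∀ k, Measurable[_, ⊤] (N.label k)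
  measurable_cue : ∀ m, Measurable (N.cue m)
  measurable_cuePower : Measurable N.cuePower
  measurable_gain : ∀ k l, Measurable (N.gain k l)
  measurable_cueGain : ∀ k m, Measurable (N.cueGain k m)
  /-- the transmitters form a homogeneous Poisson point process of density `lam` in the plane -/
  poisson : IsPoissonPointProcess P (ENNReal.ofReal N.lam • (volume : Measure Plane))
    fun ω => Measure.sum fun k => Measure.dirac (N.tx k ω)
  /-- each receiver is uniformly distributed in the disk of radius `RD` around its transmitter -/
  offset_uniform : ∀ k, pdf.IsUniform (N.offset k) (Metric.closedBall 0 N.RD) P volume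
  /-- the pairs (displacement, power) of the links are identically distributed -/
  mark_ident : ∀ k l, IdentDistrib (fun ω => (N.offset k ω, N.power k ω))
    (fun ω => (N.offset l ω, N.power l ω)) P P
  power_pos : ∀ k, ∀ᵐ ω ∂P, 0 < N.power k ω
  power_moment : ∀ k, Integrable (fun ω => N.power k ω ^ (2 / N.α)) P
  /-- the marks of the links are identically distributed -/
  label_ident : ∀ k l m, P {ω | N.label k ω = m} = P {ω | N.label l ω = m}
  /-- the cellular users are uniformly distributed in the cell -/
  cue_uniform : ∀ m, pdf.IsUniform (N.cue m) N.cell P volume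
  cuePower_nonneg : ∀ᵐ ω ∂P, 0 ≤ N.cuePower ω
  /-- Rayleigh fading: the squared moduli of the channel gains are exponential of rate one -/
  gain_law : ∀ k l, P.map (fun ω => ‖N.gain k l ω‖ ^ 2) = expMeasure 1
  cueGain_law : ∀ k m, P.map (fun ω => ‖N.cueGain k m ω‖ ^ 2) = expMeasure 1
  /-- all the sources of randomness are mutually independent -/
  indep : iIndep N.sigmaAlg P

/-- Power `p |h|² d^(-α)` received over a link with transmit power `p`, channel gain `h` and
length `d`. -/
noncomputable def rxPower (N : D2DNetwork Ω M) (p : ℝ) (h : ℂ) (d : ℝ) : ℝ≥0∞ :=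
  ENNReal.ofReal p * ENNReal.ofReal (‖h‖ ^ 2) * ENNReal.ofReal d ^ (-N.α)

/-- Interference at the `k`-th D2D receiver from the other D2D transmitters that share the
resource of the `m`-th cellular user. -/
noncomputable def d2dInterference (N : D2DNetwork Ω M) (m : Fin M) (k : ℕ) (ω : Ω) : ℝ≥0∞ :=
  ∑' i : {i : ℕ // i ≠ k ∧ N.label i ω = m},
    N.rxPower (N.power i ω) (N.gain k i ω) (dist (N.rx k ω) (N.tx i ω))

/-- Interference at the `k`-th D2D receiver from the `m`-th cellular user. -/
noncomputable def cueInterference (N : D2DNetwork Ω M) (m : Fin M) (k : ℕ) (ω : Ω) : ℝ≥0∞ :=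
  N.rxPower (N.cuePower ω) (N.cueGain k m ω) (dist (N.rx k ω) (N.cue m ω))

/-- Signal to interference plus noise ratio at the `k`-th D2D receiver, for a link that shares the
resource of the `m`-th cellular user. -/
noncomputable def sinr (N : D2DNetwork Ω M) (m : Fin M) (k : ℕ) (ω : Ω) : ℝ≥0∞ :=
  N.rxPower (N.power k ω) (N.gain k k ω) (N.linkDist k ω) /
    (N.d2dInterference m k ω + N.cueInterference m k ω + ENNReal.ofReal (N.σ ^ 2))

/-- The event that the `k`-th link has its receiver in the cell and shares the resource of the
`m`-th cellular user. -/
def inGroup (N : D2DNetwork Ω M) (m : Fin M) (k : ℕ) : Set Ω :=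
  {ω | N.label k ω = m ∧ N.rx k ω ∈ N.cell}

/-- Expected number of links of the cell that share the resource of the `m`-th cellular user
(a sum of probabilities over all links). -/
noncomputable def meanLinks [MeasurableSpace Ω] (N : D2DNetwork Ω M) (P : Measure Ω)
    (m : Fin M) : ℝ≥0∞ :=
  ∑' k, P (N.inGroup m k)

/-- Coverage probability of the typical D2D link that shares the resource of the `m`-th cellular
user, i.e. the probability of `SINR ≥ β` under the Palm distribution: the expected number of such
links of the cell with `SINR ≥ β`, divided by the expected number of such links of the cell. -/
noncomputable def coverage [MeasurableSpace Ω] (N : D2DNetwork Ω M) (P : Measure Ω)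
    (m : Fin M) (β : ℝ) : ℝ≥0∞ :=
  (∑' k, P (N.inGroup m k ∩ {ω | ENNReal.ofReal β ≤ N.sinr m k ω})) / N.meanLinks P m

/-- The random variable `Z = d_{k,k}^α / p_k`. -/
noncomputable def Z (N : D2DNetwork Ω M) (k : ℕ) (ω : Ω) : ℝ := N.linkDist k ω ^ N.α / N.power k ω

/-- The random variable `Y = |h_{k,c_m}|² d_{k,c_m}^(-α) p_0` for a receiver at the point `u`. -/
noncomputable def Y (N : D2DNetwork Ω M) (m : Fin M) (k : ℕ) (u : Plane) (ω : Ω) : ℝ :=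
  ‖N.cueGain k m ω‖ ^ 2 * dist u (N.cue m ω) ^ (-N.α) * N.cuePower ω

/-- The Laplace transform of `Y` at `s`, the receiver being uniformly distributed in the cell and
independent of the cellular user. -/
noncomputable def laplaceY [MeasurableSpace Ω] (N : D2DNetwork Ω M) (P : Measure Ω)
    (m : Fin M) (k : ℕ) (s : ℝ) : ℝ :=
  ∫ u, ∫ ω, Real.exp (-(s * N.Y m k u ω)) ∂P ∂(ProbabilityTheory.cond volume N.cell)

/-- The constant `θ_k`; here `sinc x = sin (π x) / (π x)`. -/
noncomputable def theta [MeasurableSpace Ω] (N : D2DNetwork Ω M) (P : Measure Ω)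
    (m : Fin M) (k : ℕ) (β : ℝ) : ℝ :=
  Real.pi * P.real {ω | N.label k ω = m} * N.lam * β ^ (2 / N.α) /
    Real.sinc (Real.pi * (2 / N.α)) * ∫ ω, N.power k ω ^ (2 / N.α) ∂P

end D2DNetwork

/-! The signal fading of link `k` is exponential and independent of everything else, so coverage,
which says that `|h_kk|²` exceeds `βZ(I + Y₀ + σ²)`, has conditional probability `exp(-βZ(I + Y₀ +
σ²))`, where `I` is the interference from D2D links and `Y₀` that from the cellular user
(`measure_covered_eq`). This splits into a product. Fix the mark of link `k` and all transmitter
positions. The remaining sources are independent, and averaging them gives the label probability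
`q`, the noise factor `exp(-βZσ²)`, a cellular factor depending on the receiver, and one factor `1 -
q * fadingLoss` for each other link, at its distance from the receiver
(`measure_covered_eq_lintegral_linkKernel`).

The sum over `k` and the average over positions are handled by the Mecke formula: the sum becomes an
integral over the location `x` of a point added to an unchanged Poisson process. The Laplace
functional of that process at the receiver is `exp(-λq ∫ fadingLoss)`, by translation invariance the
same for every receiver. Only the cellular factor depends on the receiver, which ranges over the
cell with Lebesgue measure; dividing by `meanLinks = λ q |cell|` makes this average uniform and
yields `laplaceY` (`tsum_lintegral_linkKernel`, `meanLinks_eq`). The planar integral of `c/(c +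
r^α)` is evaluated with Gamma functions and the reflection formula, and produces `θ Z^(2/α)`
(`lintegral_one_sub_inv_one_add_mul_rpow`, `lam_mul_lintegral_fadingLoss`).

The Mecke formula itself is derived from Poisson counts and their independence. The Laplace
functional comes from simple functions and a limit (`lintegral_expNeg`). Its derivative at `t = 0`
along `f + t·1_A` identifies `E[Φ(A) exp(-Φf)]` (`lintegral_count_mul_expNeg`), which is the Mecke
formula for a fixed `f`. An `f` that depends on the selected point is reached through countably
valued dependence and a limit (`mecke_of_fixed`, `mecke_of_countable`, `mecke_of_tendsto`,
`mecke_dist`).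

The cdf of `Z` follows by conditioning on the power. -/

/-! ### The function `exp (-t)` for `t : ℝ≥0∞` -/

/-- The function `t ↦ exp (-t)` on `[0, ∞]`. -/
noncomputable def expNeg (t : ℝ≥0∞) : ℝ≥0∞ := EReal.exp (-(t : EReal))

/-- The function `x ↦ -log x`, with values in `[0, ∞]`. -/
noncomputable def negLog (x : ℝ≥0∞) : ℝ≥0∞ := (-(ENNReal.log x)).toENNReal

@[simp] lemma expNeg_zero : expNeg 0 = 1 := by simp [expNeg]

@[simp] lemma expNeg_top : expNeg ∞ = 0 := by simp [expNeg]

lemma expNeg_add (s t : ℝ≥0∞) : expNeg (s + t) = expNeg s * expNeg t := by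
  rw [expNeg, expNeg, expNeg, ← EReal.exp_add, EReal.coe_ennreal_add, EReal.neg_add, sub_eq_add_neg]
  · left; simp
  · right; simp

lemma continuous_expNeg : Continuous expNeg :=
  ENNReal.continuous_exp.comp (continuous_neg.comp continuous_coe_ennreal_ereal)

lemma measurable_expNeg : Measurable expNeg := continuous_expNeg.measurable

@[fun_prop]
lemma Measurable.expNeg {X : Type*} [MeasurableSpace X] {f : X → ℝ≥0∞} (hf : Measurable f) :
    Measurable fun x => expNeg (f x) :=
  measurable_expNeg.comp hf

lemma antitone_expNeg : Antitone expNeg := fun _ _ h =>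
  EReal.exp_monotone (EReal.neg_le_neg_iff.2 (EReal.coe_ennreal_le_coe_ennreal_iff.2 h))

lemma expNeg_le_one (t : ℝ≥0∞) : expNeg t ≤ 1 := by
  simpa using antitone_expNeg (zero_le (a := t))

lemma expNeg_ne_top (t : ℝ≥0∞) : expNeg t ≠ ∞ :=
  ((expNeg_le_one t).trans_lt ENNReal.one_lt_top).ne

lemma expNeg_eq_zero_iff {t : ℝ≥0∞} : expNeg t = 0 ↔ t = ∞ := by
  rw [expNeg, EReal.exp_eq_zero_iff, EReal.neg_eq_bot_iff, EReal.coe_ennreal_eq_top_iff]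

lemma expNeg_ofReal {x : ℝ} (hx : 0 ≤ x) :
    expNeg (ENNReal.ofReal x) = ENNReal.ofReal (Real.exp (-x)) := by
  rw [expNeg, EReal.coe_ennreal_ofReal, max_eq_left hx, ← EReal.coe_neg, EReal.exp_coe]

lemma expNeg_mul_natCast (c : ℝ≥0∞) (n : ℕ) : expNeg (c * n) = expNeg c ^ n := by
  induction n with
  | zero => simp
  | succ n ih => rw [Nat.cast_succ, mul_add, mul_one, expNeg_add, ih, pow_succ]

lemma expNeg_sum {ι : Type*} (s : Finset ι) (f : ι → ℝ≥0∞) :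
    expNeg (∑ i ∈ s, f i) = ∏ i ∈ s, expNeg (f i) := by
  classical
  induction s using Finset.induction_on with
  | empty => simp
  | insert a s ha ih => rw [Finset.sum_insert ha, Finset.prod_insert ha, expNeg_add, ih]

/-- Sums in `[0, ∞]` always converge and `expNeg` is continuous up to `∞`, so infinite products
written this way need no summability condition. -/
lemma tendsto_prod_expNeg {ι : Type*} (f : ι → ℝ≥0∞) :
    Filter.Tendsto (fun s : Finset ι => ∏ i ∈ s, expNeg (f i)) Filter.atTop
      (nhds (expNeg (∑' i, f i))) := by
  simp_rw [← expNeg_sum]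
  exact (continuous_expNeg.tendsto _).comp ENNReal.summable.hasSum

lemma measurable_negLog : Measurable negLog :=
  (measurable_ereal_toENNReal.comp (measurable_neg.comp ENNReal.measurable_log))

lemma continuous_negLog : Continuous negLog :=
  EReal.continuous_toENNReal.comp (continuous_neg.comp ENNReal.continuous_log)

lemma antitone_negLog : Antitone negLog := fun _ _ h =>
  EReal.toENNReal_le_toENNReal (EReal.neg_le_neg_iff.2 (ENNReal.log_le_log h))

lemma expNeg_negLog {x : ℝ≥0∞} (hx : x ≤ 1) : expNeg (negLog x) = x := by
  rw [expNeg, negLog, EReal.coe_toENNReal, neg_neg, ENNReal.exp_log]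
  rw [← neg_zero, EReal.neg_le_neg_iff]
  simpa using hx

lemma negLog_ne_top {x : ℝ≥0∞} (hx : x ≤ 1) (h0 : x ≠ 0) : negLog x ≠ ∞ := by
  rw [Ne, ← expNeg_eq_zero_iff, expNeg_negLog hx]
  exact h0

/-! ### Poisson and exponential distributions -/

/-- The probability generating function of the Poisson law, by the exponential series. -/
lemma lintegral_pow_poissonMeasure (r : ℝ≥0) {x : ℝ≥0∞} (hx : x ≤ 1) :
    ∫⁻ n, x ^ n ∂(poissonMeasure r) = expNeg (r * (1 - x)) := by
  lift x to ℝ≥0 using ne_top_of_le_ne_top ENNReal.one_ne_top hx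
  have hx' : (x : ℝ) ≤ 1 := by exact_mod_cast hx
  have h1 : (r : ℝ≥0∞) * (1 - x) = ENNReal.ofReal (r * (1 - x)) := by
    rw [ENNReal.ofReal_mul r.coe_nonneg, ENNReal.ofReal_sub _ x.coe_nonneg]
    simp
  rw [h1, expNeg_ofReal (mul_nonneg r.coe_nonneg (by linarith)), poissonMeasure]
  simp only [lintegral_sum_measure, lintegral_smul_measure, lintegral_dirac, smul_eq_mul]
  have h2 : ∀ n : ℕ, ENNReal.ofReal (Real.exp (-r) * r ^ n / (n.factorial)) * (x : ℝ≥0∞) ^ n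
      = ENNReal.ofReal (Real.exp (-r) * ((r * x : ℝ) ^ n / n.factorial)) := by
    intro n
    have : (x : ℝ≥0∞) ^ n = ENNReal.ofReal ((x : ℝ) ^ n) := by
      rw [ENNReal.ofReal_pow x.coe_nonneg]; simp
    rw [this, ← ENNReal.ofReal_mul (by positivity)]
    congr 1
    rw [mul_pow]; ring
  simp_rw [h2]
  have h3 : HasSum (fun n : ℕ => Real.exp (-r) * ((r * x : ℝ) ^ n / n.factorial))
      (Real.exp (-r) * Real.exp (r * x)) := by
    have := (NormedSpace.expSeries_div_hasSum_exp ((r * x : ℝ))).mul_left (Real.exp (-r))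
    rwa [← Real.exp_eq_exp_ℝ] at this
  rw [← ENNReal.ofReal_tsum_of_nonneg (fun n => by positivity) h3.summable, h3.tsum_eq,
    ← Real.exp_add]
  congr 2; ring

lemma lintegral_expMeasure_one {f : ℝ → ℝ≥0∞} (hf : Measurable f) :
    ∫⁻ x, f x ∂(expMeasure 1) = ∫⁻ x in Set.Ioi 0, f x * ENNReal.ofReal (Real.exp (-x)) := by
  have h : expMeasure 1 = volume.withDensity (exponentialPDF 1) := rfl
  have hm : Measurable (exponentialPDF 1) := (measurable_exponentialPDFReal 1).ennreal_ofReal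
  rw [h, lintegral_withDensity_eq_lintegral_mul _ hm hf, ← lintegral_add_compl _ measurableSet_Ioi,
    Set.compl_Ioi, ← setLIntegral_congr Iio_ae_eq_Iic]
  have h0 : ∫⁻ x in Set.Iio (0 : ℝ), (exponentialPDF 1 * f) x = 0 := by
    rw [setLIntegral_congr_fun measurableSet_Iio (g := fun _ => 0), lintegral_zero]
    intro x hx
    simp [exponentialPDF_of_neg hx]
  rw [h0, add_zero]
  refine setLIntegral_congr_fun measurableSet_Ioi fun x hx => ?_
  simp [exponentialPDF_of_nonneg (le_of_lt hx), mul_comm]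

lemma lintegral_exp_neg_mul_Ioi {a t : ℝ} (ha : 0 < a) :
    ∫⁻ x in Set.Ioi t, ENNReal.ofReal (Real.exp (-(a * x)))
      = ENNReal.ofReal (Real.exp (-(a * t)) / a) := by
  have h := integral_exp_mul_Ioi (a := -a) (by linarith) t
  have hi := integrableOn_exp_mul_Ioi (a := -a) (by linarith) t
  simp only [neg_mul] at h hi
  rw [← ofReal_integral_eq_lintegral_ofReal hi (ae_of_all _ fun x => (Real.exp_pos _).le), h]
  congr 1
  field_simp

/-- The tail of the exponential distribution. -/
lemma expMeasure_one_tail (T : ℝ≥0∞) : expMeasure 1 {x | T ≤ ENNReal.ofReal x} = expNeg T := by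
  have hm : MeasurableSet {x : ℝ | T ≤ ENNReal.ofReal x} :=
    measurableSet_le measurable_const ENNReal.measurable_ofReal
  rw [← lintegral_indicator_one hm, lintegral_expMeasure_one (measurable_one.indicator hm)]
  by_cases hT : T = ∞
  · simp [hT]
  lift T to ℝ≥0 using hT
  have h1 : ∀ x ∈ Set.Ioi (0 : ℝ), {x : ℝ | (T : ℝ≥0∞) ≤ ENNReal.ofReal x}.indicator 1 x *
      ENNReal.ofReal (Real.exp (-x)) =
      (Set.Ici (T : ℝ)).indicator (fun x => ENNReal.ofReal (Real.exp (-x))) x := by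
    intro x hx
    have : (T : ℝ≥0∞) ≤ ENNReal.ofReal x ↔ (T : ℝ) ≤ x := by
      rw [← ENNReal.ofReal_coe_nnreal, ENNReal.ofReal_le_ofReal_iff (le_of_lt hx)]
    by_cases h : (T : ℝ) ≤ x <;> simp [Set.indicator, this, h]
  rw [setLIntegral_congr_fun measurableSet_Ioi h1, lintegral_indicator measurableSet_Ici,
    Measure.restrict_restrict measurableSet_Ici]
  -- For `T = 0` the two sets differ by the endpoint, so only almost everywhere equality is
  -- available.
  have h2 : (Set.Ici (T : ℝ) ∩ Set.Ioi 0 : Set ℝ) =ᵐ[volume] Set.Ioi (T : ℝ) := by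
    have h3 : Set.Ioi (T : ℝ) ∩ Set.Ioi 0 = Set.Ioi (T : ℝ) :=
      Set.inter_eq_left.2 (Set.Ioi_subset_Ioi T.coe_nonneg)
    have h4 := (Ioi_ae_eq_Ici (μ := volume) (a := (T : ℝ))).symm.inter
      (ae_eq_refl (Set.Ioi (0 : ℝ)))
    exact h4.trans (Filter.EventuallyEq.of_eq h3)
  rw [Measure.restrict_congr_set h2]
  have := lintegral_exp_neg_mul_Ioi (a := 1) (t := T) one_pos
  simp only [one_mul, div_one] at this
  rw [this, ← expNeg_ofReal T.coe_nonneg, ENNReal.ofReal_coe_nnreal]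

/-- The Laplace transform of the exponential distribution. -/
lemma lintegral_expNeg_expMeasure_one (c : ℝ≥0∞) :
    ∫⁻ x, expNeg (c * ENNReal.ofReal x) ∂(expMeasure 1) = (1 + c)⁻¹ := by
  rw [lintegral_expMeasure_one (f := fun x => expNeg (c * ENNReal.ofReal x))
    (measurable_const.mul ENNReal.measurable_ofReal).expNeg]
  by_cases hc : c = ∞
  · rw [setLIntegral_congr_fun measurableSet_Ioi (g := fun _ => 0)]
    · simp [hc]
    · intro x hx
      have : ENNReal.ofReal x ≠ 0 := by simpa using hx
      simp [hc, this]
  lift c to ℝ≥0 using hc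
  have h1 : ∀ x ∈ Set.Ioi (0 : ℝ), expNeg (c * ENNReal.ofReal x) * ENNReal.ofReal (Real.exp (-x))
      = ENNReal.ofReal (Real.exp (-((c + 1) * x))) := by
    intro x hx
    have hx : 0 < x := hx
    rw [← ENNReal.ofReal_coe_nnreal, ← ENNReal.ofReal_mul c.coe_nonneg, expNeg_ofReal (by positivity),
      ← ENNReal.ofReal_mul (Real.exp_pos _).le, ← Real.exp_add]
    congr 2; ring
  have hc : (0 : ℝ) < c + 1 := by positivity
  rw [setLIntegral_congr_fun measurableSet_Ioi h1, lintegral_exp_neg_mul_Ioi hc]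
  rw [mul_zero, neg_zero, Real.exp_zero, one_div, ENNReal.ofReal_inv_of_pos hc,
    ENNReal.ofReal_add c.coe_nonneg zero_le_one, ENNReal.ofReal_one, ENNReal.ofReal_coe_nnreal, add_comm]

/-! ### Independence -/

/-- Integrating a function of two independent random variables. -/
lemma lintegral_comp_of_indepFun {Ω E F : Type*} [MeasurableSpace Ω] [MeasurableSpace E]
    [MeasurableSpace F] {P : Measure Ω} [IsProbabilityMeasure P] {U : Ω → E} {V : Ω → F}
    (hU : Measurable U) (hV : Measurable V) (h : IndepFun U V P) {G : E → F → ℝ≥0∞}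
    (hG : Measurable (Function.uncurry G)) :
    ∫⁻ ω, G (U ω) (V ω) ∂P = ∫⁻ ω, ∫⁻ ω', G (U ω) (V ω') ∂P ∂P := by
  have h1 := (indepFun_iff_map_prod_eq_prod_map_map hU.aemeasurable hV.aemeasurable).1 h
  have : IsProbabilityMeasure (P.map V) := Measure.isProbabilityMeasure_map hV.aemeasurable
  have : IsProbabilityMeasure (P.map U) := Measure.isProbabilityMeasure_map hU.aemeasurable
  calc ∫⁻ ω, G (U ω) (V ω) ∂P
      = ∫⁻ z, Function.uncurry G z ∂(P.map fun ω => (U ω, V ω)) :=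
        (lintegral_map hG (hU.prodMk hV)).symm
    _ = ∫⁻ x, ∫⁻ y, Function.uncurry G (x, y) ∂(P.map V) ∂(P.map U) := by
        rw [h1, lintegral_prod _ hG.aemeasurable]
    _ = ∫⁻ ω, ∫⁻ y, Function.uncurry G (U ω, y) ∂(P.map V) ∂P :=
        lintegral_map hG.lintegral_prod_right' hU
    _ = _ := by
        refine lintegral_congr fun ω => ?_
        exact lintegral_map (hG.comp measurable_prodMk_left) hV

/-! ### Poisson point processes -/

lemma lintegral_natCast_poissonMeasure (r : ℝ≥0) :
    ∫⁻ n, (n : ℝ≥0∞) ∂(poissonMeasure r) = r := by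
  have h0 : ∫⁻ n, (n : ℝ≥0∞) ∂(poissonMeasure r)
      = ∑' n : ℕ, ENNReal.ofReal (Real.exp (-r) * r ^ n / n.factorial) * n := by
    rw [poissonMeasure]
    simp only [lintegral_sum_measure, lintegral_smul_measure, lintegral_dirac, smul_eq_mul]
  have h1 : ∀ n : ℕ, ENNReal.ofReal (Real.exp (-r) * r ^ (n + 1) / (n + 1).factorial) *
      ((n + 1 : ℕ) : ℝ≥0∞) = r * ENNReal.ofReal (Real.exp (-r) * r ^ n / n.factorial) := by
    intro n
    rw [← ENNReal.ofReal_natCast, ← ENNReal.ofReal_coe_nnreal (p := r),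
      ← ENNReal.ofReal_mul (by positivity), ← ENNReal.ofReal_mul (by positivity)]
    congr 1
    rw [Nat.factorial_succ]
    push_cast
    field_simp
    ring
  rw [h0, tsum_eq_zero_add' ENNReal.summable]
  simp_rw [h1]
  rw [ENNReal.tsum_mul_left, ← ENNReal.ofReal_tsum_of_nonneg (fun n => by positivity)
    (hasSum_one_poissonMeasure r).summable, (hasSum_one_poissonMeasure r).tsum_eq]
  simp

/-- Every measurable set is the increasing union of its traces on the spanning sets of `Λ`. No
finiteness of `μ` or `ν` is needed, so this applies to the sums of laws below. -/
lemma Measure.ext_of_finite_sets {S : Type*} [MeasurableSpace S] (Λ : Measure S) [SigmaFinite Λ]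
    {μ ν : Measure S} (h : ∀ A, MeasurableSet A → Λ A ≠ ∞ → μ A = ν A) : μ = ν := by
  ext A hA
  have hU : A = ⋃ n, A ∩ spanningSets Λ n := by
    rw [← Set.inter_iUnion, iUnion_spanningSets, Set.inter_univ]
  have hmono : Monotone fun n => A ∩ spanningSets Λ n := fun i j hij =>
    Set.inter_subset_inter_right _ (monotone_spanningSets Λ hij)
  rw [hU, hmono.measure_iUnion, hmono.measure_iUnion]
  refine iSup_congr fun n => h _ (hA.inter (measurableSet_spanningSets Λ n)) ?_
  exact ((measure_mono Set.inter_subset_right).trans_lt (measure_spanningSets_lt_top Λ n)).ne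

namespace IsPoissonPointProcess

variable {Ω S : Type*} [MeasurableSpace Ω] [MeasurableSpace S] {P : Measure Ω}
  {Λ : Measure S} {Φ : Ω → Measure S}

lemma measurable (h : IsPoissonPointProcess P Λ Φ) : Measurable Φ :=
  Measure.measurable_of_measurable_coe _ h.measurable_count

lemma measurable_lintegral (h : IsPoissonPointProcess P Λ Φ) {f : S → ℝ≥0∞} (hf : Measurable f) :
    Measurable fun ω => ∫⁻ x, f x ∂(Φ ω) :=
  (Measure.measurable_lintegral hf).comp h.measurable

lemma lintegral_count_eq (h : IsPoissonPointProcess P Λ Φ) {A : Set S} (hA : MeasurableSet A)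
    (hΛ : Λ A ≠ ∞) : ∫⁻ ω, Φ ω A ∂P = Λ A := by
  rw [← lintegral_map (f := fun x => x) measurable_id (h.measurable_count A hA),
    h.poisson_count A hA hΛ, lintegral_map (f := fun x => x) measurable_id .of_discrete,
    lintegral_natCast_poissonMeasure, ENNReal.coe_toNNReal hΛ]

/-- Finite intensity is required only for `c ≠ 0`: the zero level of a simple function usually has
infinite intensity and contributes nothing. -/
lemma lintegral_expNeg_mul_count [IsProbabilityMeasure P] (h : IsPoissonPointProcess P Λ Φ)
    {A : Set S} (hA : MeasurableSet A) {c : ℝ≥0∞} (hΛ : c ≠ 0 → Λ A ≠ ∞) :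
    ∫⁻ ω, expNeg (c * Φ ω A) ∂P = expNeg ((1 - expNeg c) * Λ A) := by
  by_cases hc : c = 0
  · simp [hc]
  have hm : Measurable fun x => expNeg (c * x) :=
    (measurable_const.mul measurable_id).expNeg
  rw [← lintegral_map (f := fun x => expNeg (c * x)) hm (h.measurable_count A hA),
    h.poisson_count A hA (hΛ hc), lintegral_map hm .of_discrete]
  simp_rw [expNeg_mul_natCast]
  rw [lintegral_pow_poissonMeasure _ (expNeg_le_one c), ENNReal.coe_toNNReal (hΛ hc), mul_comm]

lemma lintegral_expNeg_simpleFunc [IsProbabilityMeasure P] (h : IsPoissonPointProcess P Λ Φ)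
    (f : SimpleFunc S ℝ≥0∞) (hf : ∀ c, c ≠ 0 → Λ (f ⁻¹' {c}) ≠ ∞) :
    ∫⁻ ω, expNeg (∫⁻ x, f x ∂(Φ ω)) ∂P = expNeg (∫⁻ x, (1 - expNeg (f x)) ∂Λ) := by
  have hR : ∫⁻ x, (1 - expNeg (f x)) ∂Λ
      = ∑ c ∈ f.range, (1 - expNeg c) * Λ (f ⁻¹' {c}) := by
    rw [← SimpleFunc.map_lintegral (fun c => 1 - expNeg c) f, ← SimpleFunc.lintegral_eq_lintegral]
    rfl
  -- The values of `f` are enumerated because `indep_count` speaks of families indexed by `Fin n`.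
  let e := f.range.equivFin
  have he : ∀ G : ℝ≥0∞ → ℝ≥0∞, ∏ c ∈ f.range, G c = ∏ i, G (e.symm i) := by
    intro G
    rw [← Finset.prod_coe_sort]
    exact Fintype.prod_equiv e _ _ (by simp)
  have hind : iIndepFun (fun i ω => expNeg ((e.symm i : ℝ≥0∞) * Φ ω (f ⁻¹' {(e.symm i : ℝ≥0∞)}))) P :=
    (h.indep_count _ (fun i => f ⁻¹' {(e.symm i : ℝ≥0∞)}) (fun i => f.measurableSet_fiber _)
      (fun i j hij => Disjoint.preimage _ (by
        simpa [Subtype.ext_iff] using fun h => hij (e.symm.injective (Subtype.ext h))))).comp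
      (fun i y => expNeg ((e.symm i : ℝ≥0∞) * y))
      (fun i => (measurable_const.mul measurable_id).expNeg)
  simp_rw [hR, expNeg_sum, SimpleFunc.lintegral_eq_lintegral, SimpleFunc.lintegral, expNeg_sum, he]
  rw [lintegral_prod_eq_prod_lintegral_of_indepFun _ _ hind]
  · exact Finset.prod_congr rfl fun i _ =>
      h.lintegral_expNeg_mul_count (f.measurableSet_fiber _) (hf _)
  · exact fun i => measurable_expNeg.comp
      (measurable_const.mul (h.measurable_count _ (f.measurableSet_fiber _)))

/-- The Laplace functional of a Poisson point process. -/
theorem lintegral_expNeg [IsProbabilityMeasure P] [SigmaFinite Λ]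
    (h : IsPoissonPointProcess P Λ Φ) {f : S → ℝ≥0∞} (hf : Measurable f) :
    ∫⁻ ω, expNeg (∫⁻ x, f x ∂(Φ ω)) ∂P = expNeg (∫⁻ x, (1 - expNeg (f x)) ∂Λ) := by
  -- Cutting the approximations off outside the spanning sets keeps the sequence increasing and
  -- gives every nonzero level finite intensity.
  let g : ℕ → SimpleFunc S ℝ≥0∞ := fun n => (SimpleFunc.eapprox f n).restrict (spanningSets Λ n)
  have hg : ∀ n x, g n x = (spanningSets Λ n).indicator (SimpleFunc.eapprox f n) x := fun n x => by
    rw [SimpleFunc.restrict_apply _ (measurableSet_spanningSets Λ n)]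
  have hmono : ∀ x, Monotone fun n => g n x := by
    intro x i j hij
    simp only [hg]
    refine (Set.indicator_le_indicator_of_subset (monotone_spanningSets Λ hij)
      (fun _ => zero_le) x).trans (Set.indicator_le_indicator ?_)
    exact SimpleFunc.monotone_eapprox f hij x
  have hlim : ∀ x, Filter.Tendsto (fun n => g n x) Filter.atTop (nhds (f x)) := by
    intro x
    refine (SimpleFunc.tendsto_eapprox hf x).congr' ?_
    filter_upwards [Filter.eventually_ge_atTop (spanningSetsIndex Λ x)] with n hn
    rw [hg, Set.indicator_of_mem]
    exact monotone_spanningSets Λ hn (mem_spanningSetsIndex Λ x)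
  have hfin : ∀ n c, c ≠ 0 → Λ (g n ⁻¹' {c}) ≠ ∞ := by
    intro n c hc
    refine ((measure_mono ?_).trans_lt (measure_spanningSets_lt_top Λ n)).ne
    intro x hx
    by_contra hx'
    have : g n x = c := hx
    rw [hg, Set.indicator_of_notMem hx'] at this
    exact hc this.symm
  have hL : Filter.Tendsto (fun n => ∫⁻ ω, expNeg (∫⁻ x, g n x ∂(Φ ω)) ∂P) Filter.atTop
      (nhds (∫⁻ ω, expNeg (∫⁻ x, f x ∂(Φ ω)) ∂P)) := by
    refine tendsto_lintegral_of_dominated_convergence (fun _ => 1)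
      (fun n => measurable_expNeg.comp (h.measurable_lintegral (g n).measurable))
      (fun n => ae_of_all _ fun ω => expNeg_le_one _) (by simp) (ae_of_all _ fun ω => ?_)
    refine (continuous_expNeg.tendsto _).comp ?_
    exact lintegral_tendsto_of_tendsto_of_monotone (fun n => (g n).measurable.aemeasurable)
      (ae_of_all _ hmono) (ae_of_all _ hlim)
  have hR : Filter.Tendsto (fun n => expNeg (∫⁻ x, (1 - expNeg (g n x)) ∂Λ)) Filter.atTop
      (nhds (expNeg (∫⁻ x, (1 - expNeg (f x)) ∂Λ))) := by
    refine (continuous_expNeg.tendsto _).comp ?_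
    refine lintegral_tendsto_of_tendsto_of_monotone
      (fun n => (measurable_const.sub ((g n).measurable.expNeg)).aemeasurable)
      (ae_of_all _ fun x i j hij => tsub_le_tsub_left (antitone_expNeg (hmono x hij)) _)
      (ae_of_all _ fun x => ?_)
    exact ENNReal.Tendsto.sub tendsto_const_nhds ((continuous_expNeg.tendsto _).comp (hlim x))
      (Or.inl ENNReal.one_ne_top)
  refine tendsto_nhds_unique hL (hR.congr fun n => ?_)
  rw [h.lintegral_expNeg_simpleFunc (g n) (hfin n)]

/-- The difference quotient of `t ↦ -exp(-tN)` at `0` along `t = 1/(n+1)`. Together with the bound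
`mul_one_sub_expNeg_le` it permits differentiation under the expectation. -/
lemma tendsto_mul_one_sub_expNeg {N : ℝ≥0∞} (hN : N ≠ ∞) :
    Filter.Tendsto (fun n : ℕ => ((n + 1 : ℕ) : ℝ≥0∞) *
      (1 - expNeg (ENNReal.ofReal (1 / ((n : ℝ) + 1)) * N))) Filter.atTop (nhds N) := by
  lift N to ℝ≥0 using hN
  have hd : HasDerivAt (fun t : ℝ => -Real.exp (-(t * N))) N 0 := by
    have := (((hasDerivAt_id (0 : ℝ)).mul_const (N : ℝ)).neg.exp).neg
    exact this.congr_deriv (by simp)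
  have h1 := (hasDerivAt_iff_tendsto_slope_zero.1 hd).comp
    (tendsto_nhdsWithin_iff.2 ⟨tendsto_one_div_add_atTop_nhds_zero_nat (𝕜 := ℝ),
      Filter.Eventually.of_forall fun n => by
        simp only [Set.mem_compl_iff, Set.mem_singleton_iff]; positivity⟩)
  have h2 := (ENNReal.continuous_ofReal.tendsto _).comp h1
  rw [ENNReal.ofReal_coe_nnreal] at h2
  refine h2.congr fun n => ?_
  simp only [Function.comp]
  rw [← ENNReal.ofReal_coe_nnreal, ← ENNReal.ofReal_mul (by positivity),
    expNeg_ofReal (by positivity), ← ENNReal.ofReal_one,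
    ← ENNReal.ofReal_sub _ (Real.exp_pos _).le, ← ENNReal.ofReal_natCast,
    ← ENNReal.ofReal_mul (by positivity)]
  congr 1
  simp only [smul_eq_mul, one_div, inv_inv, zero_add, zero_mul, neg_zero, Real.exp_zero]
  push_cast
  ring

lemma mul_one_sub_expNeg_le (N : ℝ≥0∞) (n : ℕ) : ((n + 1 : ℕ) : ℝ≥0∞) *
      (1 - expNeg (ENNReal.ofReal (1 / ((n : ℝ) + 1)) * N)) ≤ N := by
  by_cases hN : N = ∞
  · simp [hN]
  lift N to ℝ≥0 using hN
  rw [← ENNReal.ofReal_coe_nnreal, ← ENNReal.ofReal_mul (by positivity),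
    expNeg_ofReal (by positivity), ← ENNReal.ofReal_one,
    ← ENNReal.ofReal_sub _ (Real.exp_pos _).le, ← ENNReal.ofReal_natCast,
    ← ENNReal.ofReal_mul (by positivity)]
  refine ENNReal.ofReal_le_ofReal ?_
  have h1 := Real.one_sub_le_exp_neg (1 / ((n : ℝ) + 1) * N)
  have h2 : ((n + 1 : ℕ) : ℝ) * (1 / ((n : ℝ) + 1) * N) = N := by push_cast; field_simp
  calc ((n + 1 : ℕ) : ℝ) * (1 - Real.exp (-(1 / ((n : ℝ) + 1) * N)))
      ≤ ((n + 1 : ℕ) : ℝ) * (1 / ((n : ℝ) + 1) * N) :=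
        mul_le_mul_of_nonneg_left (by linarith) (by positivity)
    _ = N := h2

/-- The matching difference quotient for the closed form `exp(-(1 - exp(-t))a)`, whose derivative at
`0` is `-a`. -/
lemma tendsto_mul_one_sub_expNeg_expNeg {a : ℝ≥0∞} (ha : a ≠ ∞) :
    Filter.Tendsto (fun n : ℕ => ((n + 1 : ℕ) : ℝ≥0∞) *
      (1 - expNeg ((1 - expNeg (ENNReal.ofReal (1 / ((n : ℝ) + 1)))) * a))) Filter.atTop
      (nhds a) := by
  lift a to ℝ≥0 using ha
  have hd : HasDerivAt (fun t : ℝ => -Real.exp (-((1 - Real.exp (-t)) * a))) a 0 := by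
    have := (((((hasDerivAt_id (0 : ℝ)).neg.exp).const_sub 1).mul_const (a : ℝ)).neg.exp).neg
    exact this.congr_deriv (by simp)
  have h1 := (hasDerivAt_iff_tendsto_slope_zero.1 hd).comp
    (tendsto_nhdsWithin_iff.2 ⟨tendsto_one_div_add_atTop_nhds_zero_nat (𝕜 := ℝ),
      Filter.Eventually.of_forall fun n => by
        simp only [Set.mem_compl_iff, Set.mem_singleton_iff]; positivity⟩)
  have h2 := (ENNReal.continuous_ofReal.tendsto _).comp h1
  rw [ENNReal.ofReal_coe_nnreal] at h2
  refine h2.congr fun n => ?_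
  simp only [Function.comp]
  have h3 : 0 ≤ 1 - Real.exp (-(1 / ((n : ℝ) + 1))) := by
    rw [sub_nonneg, Real.exp_le_one_iff]; exact neg_nonpos.2 (by positivity)
  rw [expNeg_ofReal (by positivity), ← ENNReal.ofReal_coe_nnreal, ← ENNReal.ofReal_one,
    ← ENNReal.ofReal_sub _ (Real.exp_pos _).le, ← ENNReal.ofReal_mul h3,
    expNeg_ofReal (by positivity),
    ← ENNReal.ofReal_sub _ (Real.exp_pos _).le, ← ENNReal.ofReal_natCast,
    ← ENNReal.ofReal_mul (by positivity)]
  congr 1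
  simp only [smul_eq_mul, one_div, inv_inv, zero_add, zero_mul, neg_zero, Real.exp_zero, sub_self]
  push_cast
  ring

/-- Both sides are minus the derivative at `t = 0` of the Laplace functional at `f + t·1_A`. -/
lemma lintegral_count_mul_expNeg [IsProbabilityMeasure P] [SigmaFinite Λ]
    (h : IsPoissonPointProcess P Λ Φ) {f : S → ℝ≥0∞} (hf : Measurable f) {A : Set S}
    (hA : MeasurableSet A) (hΛ : Λ A ≠ ∞) :
    ∫⁻ ω, Φ ω A * expNeg (∫⁻ x, f x ∂(Φ ω)) ∂P
      = (∫⁻ x in A, expNeg (f x) ∂Λ) * ∫⁻ ω, expNeg (∫⁻ x, f x ∂(Φ ω)) ∂P := by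
  set L := ∫⁻ ω, expNeg (∫⁻ x, f x ∂(Φ ω)) ∂P with hL
  set a := ∫⁻ x in A, expNeg (f x) ∂Λ with ha
  have hXm := (h.measurable_lintegral hf).expNeg
  have hLtop : L ≠ ∞ := by
    refine ne_top_of_le_ne_top ENNReal.one_ne_top ((lintegral_mono fun ω => expNeg_le_one _).trans ?_)
    simp
  have hatop : a ≠ ∞ := by
    refine ne_top_of_le_ne_top hΛ ((lintegral_mono fun ω => expNeg_le_one _).trans ?_)
    simp
  have hNtop : ∀ᵐ ω ∂P, Φ ω A ≠ ∞ :=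
    (ae_lt_top (h.measurable_count A hA) (by rwa [h.lintegral_count_eq hA hΛ])).mono
      fun ω hω => hω.ne
  have h1 : ∀ t : ℝ≥0∞, ∫⁻ ω, expNeg (t * Φ ω A) * expNeg (∫⁻ x, f x ∂(Φ ω)) ∂P
      = L * expNeg ((1 - expNeg t) * a) := by
    intro t
    have hft : Measurable fun x => f x + A.indicator (fun _ => t) x :=
      hf.add (measurable_const.indicator hA)
    have h2 := h.lintegral_expNeg hft
    have hm1 : Measurable fun x => 1 - expNeg (f x) := measurable_const.sub hf.expNeg
    have h3 : ∀ ω, ∫⁻ x, (f x + A.indicator (fun _ => t) x) ∂(Φ ω)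
        = ∫⁻ x, f x ∂(Φ ω) + t * Φ ω A := by
      intro ω
      rw [lintegral_add_left hf, lintegral_indicator_const hA]
    -- The perturbation enters the exponent only on `A`, with weight `(1 - exp(-t))exp(-f)`; this
    -- makes the functional factor.
    have h4 : ∀ x, 1 - expNeg (f x + A.indicator (fun _ => t) x)
        = (1 - expNeg (f x)) + A.indicator (fun x => (1 - expNeg t) * expNeg (f x)) x := by
      intro x
      by_cases hx : x ∈ A
      · simp only [Set.indicator_of_mem hx]
        rw [expNeg_add, ENNReal.sub_mul (fun _ _ => expNeg_ne_top _), one_mul,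
          mul_comm (expNeg t), tsub_add_tsub_cancel (expNeg_le_one _)]
        exact mul_le_of_le_one_right' (expNeg_le_one t)
      · simp [Set.indicator_of_notMem hx]
    simp_rw [h3, h4] at h2
    rw [lintegral_add_left hm1,
      lintegral_indicator hA, lintegral_const_mul _ hf.expNeg, expNeg_add,
      ← h.lintegral_expNeg hf] at h2
    rw [← h2]
    exact lintegral_congr fun ω => by rw [expNeg_add, mul_comm]
  have h5 : ∀ n : ℕ, ∫⁻ ω, ((n + 1 : ℕ) : ℝ≥0∞) *
      (1 - expNeg (ENNReal.ofReal (1 / ((n : ℝ) + 1)) * Φ ω A)) * expNeg (∫⁻ x, f x ∂(Φ ω)) ∂P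
      = ((n + 1 : ℕ) : ℝ≥0∞) *
      (1 - expNeg ((1 - expNeg (ENNReal.ofReal (1 / ((n : ℝ) + 1)))) * a)) * L := by
    intro n
    set t := ENNReal.ofReal (1 / ((n : ℝ) + 1))
    have hm : Measurable fun ω => expNeg (t * Φ ω A) * expNeg (∫⁻ x, f x ∂(Φ ω)) :=
      ((measurable_const.mul (h.measurable_count A hA)).expNeg).mul hXm
    have hm1 : Measurable fun ω => expNeg (∫⁻ x, f x ∂(Φ ω)) -
        expNeg (t * Φ ω A) * expNeg (∫⁻ x, f x ∂(Φ ω)) := hXm.sub hm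
    simp_rw [mul_assoc, ENNReal.sub_mul (fun _ _ => expNeg_ne_top _), one_mul]
    rw [ENNReal.sub_mul (fun _ _ => hLtop), one_mul, mul_comm _ L, ← h1,
      lintegral_const_mul _ hm1, lintegral_sub hm]
    · rw [h1]
      exact ENNReal.mul_ne_top hLtop (expNeg_ne_top _)
    · exact ae_of_all _ fun ω => mul_le_of_le_one_left' (expNeg_le_one _)
  have h6 : Filter.Tendsto (fun n : ℕ => ∫⁻ ω, ((n + 1 : ℕ) : ℝ≥0∞) *
      (1 - expNeg (ENNReal.ofReal (1 / ((n : ℝ) + 1)) * Φ ω A)) * expNeg (∫⁻ x, f x ∂(Φ ω)) ∂P)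
      Filter.atTop (nhds (∫⁻ ω, Φ ω A * expNeg (∫⁻ x, f x ∂(Φ ω)) ∂P)) := by
    -- The quotients are dominated by the count `Φ(A)`, whose mean `Λ A` is finite.
    refine tendsto_lintegral_of_dominated_convergence (fun ω => Φ ω A) (fun n => ?_)
      (fun n => ae_of_all _ fun ω => ?_) ?_ ?_
    · exact (measurable_const.mul (measurable_const.sub (measurable_expNeg.comp
        (measurable_const.mul (h.measurable_count A hA))))).mul hXm
    · exact (mul_le_of_le_one_right' (expNeg_le_one _)).trans (mul_one_sub_expNeg_le _ n)
    · rwa [h.lintegral_count_eq hA hΛ]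
    · filter_upwards [hNtop] with ω hω
      exact ENNReal.Tendsto.mul_const (tendsto_mul_one_sub_expNeg hω) (Or.inr (expNeg_ne_top _))
  simp_rw [h5] at h6
  exact tendsto_nhds_unique h6
    (ENNReal.Tendsto.mul_const (tendsto_mul_one_sub_expNeg_expNeg hatop) (Or.inr hLtop))

end IsPoissonPointProcess

/-! ### The Mecke formula -/

/-- The limiting sum may be infinite, so dominated convergence does not apply. Fatou's lemma gives
the lower bound and the termwise inequality the upper one. -/
lemma ENNReal.tendsto_tsum_of_le_of_tendsto {a : ℕ → ℕ → ℝ≥0∞} {b : ℕ → ℝ≥0∞}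
    (hle : ∀ n i, a n i ≤ b i)
    (hlim : ∀ i, Filter.Tendsto (fun n => a n i) Filter.atTop (nhds (b i))) :
    Filter.Tendsto (fun n => ∑' i, a n i) Filter.atTop (nhds (∑' i, b i)) := by
  refine tendsto_of_le_liminf_of_limsup_le ?_ ?_
  · have h := lintegral_liminf_le (μ := (Measure.count : Measure ℕ)) (u := Filter.atTop)
      (f := a) (fun n => .of_discrete)
    simp_rw [lintegral_count, (hlim _).liminf_eq] at h
    exact h
  · exact Filter.limsup_le_of_le (by isBoundedDefault)
      (Filter.Eventually.of_forall fun n => ENNReal.tsum_le_tsum (hle n))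

namespace IsPoissonPointProcess

variable {Ω S : Type*} [MeasurableSpace Ω] [MeasurableSpace S] {P : Measure Ω}
  {Λ : Measure S} {X : ℕ → Ω → S}

lemma lintegral_sum_dirac (x : ℕ → S) {f : S → ℝ≥0∞} (hf : Measurable f) :
    ∫⁻ z, f z ∂(Measure.sum fun k => Measure.dirac (x k)) = ∑' k, f (x k) := by
  simp_rw [lintegral_sum_measure, lintegral_dirac' _ hf]

/-- Campbell's formula: the intensity measure of a Poisson point process. -/
lemma sum_map [SigmaFinite Λ] (hX : ∀ k, Measurable (X k))
    (h : IsPoissonPointProcess P Λ fun ω => Measure.sum fun k => Measure.dirac (X k ω)) :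
    Measure.sum (fun k => P.map (X k)) = Λ := by
  refine Measure.ext_of_finite_sets Λ fun A hA hΛ => ?_
  rw [← h.lintegral_count_eq hA hΛ, Measure.sum_apply _ hA]
  simp_rw [Measure.sum_apply _ hA, Measure.dirac_apply' _ hA]
  have hAX : ∀ k, Measurable fun ω => A.indicator (1 : S → ℝ≥0∞) (X k ω) :=
    fun k => (measurable_one.indicator hA).comp (hX k)
  rw [lintegral_tsum fun k => (hAX k).aemeasurable]
  refine tsum_congr fun k => ?_
  rw [Measure.map_apply (hX k) hA, ← lintegral_indicator_one (hX k hA)]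
  rfl

lemma tsum_lintegral [SigmaFinite Λ] (hX : ∀ k, Measurable (X k))
    (h : IsPoissonPointProcess P Λ fun ω => Measure.sum fun k => Measure.dirac (X k ω))
    {F : S → ℝ≥0∞} (hF : Measurable F) :
    ∑' k, ∫⁻ ω, F (X k ω) ∂P = ∫⁻ x, F x ∂Λ := by
  rw [← h.sum_map hX, lintegral_sum_measure]
  exact tsum_congr fun k => (lintegral_map hF (hX k)).symm

variable [IsProbabilityMeasure P] [SigmaFinite Λ]

lemma lintegral_expNeg_tsum
    (h : IsPoissonPointProcess P Λ fun ω => Measure.sum fun k => Measure.dirac (X k ω))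
    {f : S → ℝ≥0∞} (hf : Measurable f) :
    ∫⁻ ω, expNeg (∑' i, f (X i ω)) ∂P = expNeg (∫⁻ x, (1 - expNeg (f x)) ∂Λ) := by
  rw [← h.lintegral_expNeg hf]
  simp_rw [lintegral_sum_dirac _ hf]

/-- The Mecke formula for functionals of the form `F x * exp (- ∑ f)`. -/
theorem mecke_of_fixed (hX : ∀ k, Measurable (X k))
    (h : IsPoissonPointProcess P Λ fun ω => Measure.sum fun k => Measure.dirac (X k ω))
    {f F : S → ℝ≥0∞} (hf : Measurable f) (hftop : ∀ x, f x ≠ ∞) (hF : Measurable F) :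
    ∑' k, ∫⁻ ω, F (X k ω) * expNeg (∑' i, if i = k then 0 else f (X i ω)) ∂P
      = (∫⁻ x, F x ∂Λ) * ∫⁻ ω, expNeg (∑' i, f (X i ω)) ∂P := by
  set W : Ω → ℝ≥0∞ := fun ω => expNeg (∑' i, f (X i ω)) with hW
  have hWm : Measurable W := (Measurable.tsum fun i => hf.comp (hX i)).expNeg
  have hpos : ∀ x, expNeg (f x) ≠ 0 := fun x => by rw [Ne, expNeg_eq_zero_iff]; exact hftop x
  -- This is `lintegral_count_mul_expNeg` read as an equality of measures in `A`; it extends the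
  -- identity from indicators to all `F`.
  have hm : Measure.sum (fun k => (P.withDensity W).map (X k))
      = (∫⁻ ω, W ω ∂P) • Λ.withDensity (fun x => expNeg (f x)) := by
    refine Measure.ext_of_finite_sets Λ fun A hA hΛ => ?_
    have h1 := h.lintegral_count_mul_expNeg hf hA hΛ
    simp_rw [lintegral_sum_dirac _ hf, Measure.sum_apply _ hA, Measure.dirac_apply' _ hA,
      ← ENNReal.tsum_mul_right] at h1
    have hAX : ∀ k, Measurable fun ω => A.indicator (1 : S → ℝ≥0∞) (X k ω) :=
      fun k => (measurable_one.indicator hA).comp (hX k)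
    have hAW : ∀ k, Measurable fun ω => A.indicator (1 : S → ℝ≥0∞) (X k ω) *
      expNeg (∑' i, f (X i ω)) := fun k => (hAX k).mul hWm
    rw [lintegral_tsum fun k => (hAW k).aemeasurable] at h1
    rw [Measure.sum_apply _ hA, Measure.smul_apply, withDensity_apply _ hA, smul_eq_mul,
      mul_comm, ← h1]
    refine tsum_congr fun k => ?_
    rw [Measure.map_apply (hX k) hA, withDensity_apply _ (hX k hA),
      ← lintegral_indicator (hX k hA)]
    refine lintegral_congr fun ω => ?_
    by_cases hω : X k ω ∈ A
    · rw [Set.indicator_of_mem (show ω ∈ X k ⁻¹' A from hω), Set.indicator_of_mem hω]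
      simp [W]
    · rw [Set.indicator_of_notMem (show ω ∉ X k ⁻¹' A from hω), Set.indicator_of_notMem hω,
        zero_mul]
  have hG : Measurable fun x => F x * (expNeg (f x))⁻¹ := hF.mul hf.expNeg.inv
  have hL : ∫⁻ x, F x * (expNeg (f x))⁻¹ ∂(Measure.sum fun k => (P.withDensity W).map (X k))
      = ∑' k, ∫⁻ ω, F (X k ω) * expNeg (∑' i, if i = k then 0 else f (X i ω)) ∂P := by
    rw [lintegral_sum_measure]
    refine tsum_congr fun k => ?_
    have hGX : Measurable fun ω => F (X k ω) * (expNeg (f (X k ω)))⁻¹ := hG.comp (hX k)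
    rw [lintegral_map hG (hX k), lintegral_withDensity_eq_lintegral_mul _ hWm hGX]
    refine lintegral_congr fun ω => ?_
    -- The factor of the selected point splits off and is cancelled by its inverse, which is
    -- possible because `f` is finite.
    have : W ω = expNeg (f (X k ω)) * expNeg (∑' i, if i = k then 0 else f (X i ω)) := by
      have h2 := ENNReal.tsum_eq_add_tsum_ite (f := fun i => f (X i ω)) k
      rw [hW, ← expNeg_add]
      exact congrArg expNeg (by convert h2)
    rw [Pi.mul_apply, this, mul_comm, mul_assoc, ← mul_assoc _ (expNeg _) (expNeg _),
      ENNReal.inv_mul_cancel (hpos _) (expNeg_ne_top _), one_mul]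
  rw [← hL, hm, lintegral_smul_measure, lintegral_withDensity_eq_lintegral_mul _ hf.expNeg hG,
    smul_eq_mul, mul_comm]
  congr 1
  refine lintegral_congr fun x => ?_
  rw [Pi.mul_apply, mul_left_comm, ENNReal.mul_inv_cancel (hpos _) (expNeg_ne_top _), mul_one]

/-- On each set `code = j` the function `f (code x)` is the fixed function `f j`, so the formula for
fixed `f` applies with `F` restricted to that set, and the pieces are summed. -/
lemma mecke_of_countable (hX : ∀ k, Measurable (X k))
    (h : IsPoissonPointProcess P Λ fun ω => Measure.sum fun k => Measure.dirac (X k ω))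
    {code : S → ℕ} (hcode : Measurable code)
    {f : ℕ → S → ℝ≥0∞} {F : S → ℝ≥0∞} (hf : ∀ j, Measurable (f j)) (hftop : ∀ j x, f j x ≠ ∞)
    (hF : Measurable F) :
    ∑' k, ∫⁻ ω, F (X k ω) * expNeg (∑' i, if i = k then 0 else f (code (X k ω)) (X i ω)) ∂P
      = ∫⁻ x, F x * ∫⁻ ω, expNeg (∑' i, f (code x) (X i ω)) ∂P ∂Λ := by
  have hset : ∀ j, MeasurableSet (code ⁻¹' {j}) := fun j => hcode (measurableSet_singleton j)
  have hsplit : ∀ (x : S) (g : ℕ → ℝ≥0∞),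
      F x * g (code x) = ∑' j, (code ⁻¹' {j}).indicator F x * g j := by
    intro x g
    rw [tsum_eq_single (code x), Set.indicator_of_mem (Set.mem_preimage.2 (Set.mem_singleton _))]
    intro j hj
    rw [Set.indicator_of_notMem (show x ∉ code ⁻¹' {j} from fun h => hj (Eq.symm h)), zero_mul]
  have hfX : ∀ k j, Measurable fun ω => expNeg (∑' i, if i = k then 0 else f j (X i ω)) := by
    intro k j
    refine (Measurable.tsum fun i => ?_).expNeg
    split_ifs
    · exact measurable_const
    · exact (hf j).comp (hX i)
  have hFi : ∀ j, Measurable ((code ⁻¹' {j}).indicator F) := fun j => hF.indicator (hset j)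
  calc _ = ∑' k, ∑' j, ∫⁻ ω, (code ⁻¹' {j}).indicator F (X k ω) *
        expNeg (∑' i, if i = k then 0 else f j (X i ω)) ∂P := by
        refine tsum_congr fun k => ?_
        have hm : ∀ j, Measurable fun ω => (code ⁻¹' {j}).indicator F (X k ω) *
            expNeg (∑' i, if i = k then 0 else f j (X i ω)) :=
          fun j => ((hFi j).comp (hX k)).mul (hfX k j)
        rw [← lintegral_tsum fun j => (hm j).aemeasurable]
        exact lintegral_congr fun ω =>
          hsplit (X k ω) fun j => expNeg (∑' i, if i = k then 0 else f j (X i ω))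
    _ = ∑' j, (∫⁻ x, (code ⁻¹' {j}).indicator F x ∂Λ) * ∫⁻ ω, expNeg (∑' i, f j (X i ω)) ∂P := by
        rw [ENNReal.tsum_comm]
        exact tsum_congr fun j => h.mecke_of_fixed hX (hf j) (hftop j) (hFi j)
    _ = _ := by
        simp_rw [fun x => hsplit x fun j => ∫⁻ ω, expNeg (∑' i, f j (X i ω)) ∂P]
        rw [lintegral_tsum fun j => ((hFi j).mul_const _).aemeasurable]
        exact tsum_congr fun j => (lintegral_mul_const _ (hFi j)).symm

/-- The approximations lie below `f`, so the inner sums converge even if infinite. Integrability of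
`F` dominates both sides. -/
lemma mecke_of_tendsto (hX : ∀ k, Measurable (X k))
    (h : IsPoissonPointProcess P Λ fun ω => Measure.sum fun k => Measure.dirac (X k ω))
    {code : ℕ → S → ℕ} (hcode : ∀ n, Measurable (code n))
    {g : ℕ → ℕ → S → ℝ≥0∞} (hg : ∀ n j, Measurable (g n j)) (hgtop : ∀ n j x, g n j x ≠ ∞)
    {f : S → S → ℝ≥0∞} (hle : ∀ n x z, g n (code n x) z ≤ f x z)
    (hlim : ∀ x z, Filter.Tendsto (fun n => g n (code n x) z) Filter.atTop (nhds (f x z)))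
    {F : S → ℝ≥0∞} (hF : Measurable F) (hFtop : ∫⁻ x, F x ∂Λ ≠ ∞) :
    ∑' k, ∫⁻ ω, F (X k ω) * expNeg (∑' i, if i = k then 0 else f (X k ω) (X i ω)) ∂P
      = ∫⁻ x, F x * ∫⁻ ω, expNeg (∑' i, f x (X i ω)) ∂P ∂Λ := by
  have hgm : ∀ n, Measurable fun p : S × S => g n (code n p.1) p.2 := by
    intro n
    have : Measurable fun q : ℕ × S => g n q.1 q.2 := measurable_from_prod_countable_right (hg n)
    exact this.comp (((hcode n).comp measurable_fst).prodMk measurable_snd)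
  have hFX := h.tsum_lintegral hX hF
  have hFk : ∀ k, ∫⁻ ω, F (X k ω) ∂P ≠ ∞ := fun k =>
    ne_top_of_le_ne_top (hFX ▸ hFtop) (ENNReal.le_tsum k)
  have hFae : ∀ᵐ x ∂Λ, F x ≠ ∞ := (ae_lt_top hF hFtop).mono fun x hx => hx.ne
  have hFXae : ∀ k, ∀ᵐ ω ∂P, F (X k ω) ≠ ∞ := fun k =>
    (ae_lt_top (hF.comp (hX k)) (hFk k)).mono fun x hx => hx.ne
  have hL : Filter.Tendsto (fun n => ∑' k, ∫⁻ ω, F (X k ω) *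
      expNeg (∑' i, if i = k then 0 else g n (code n (X k ω)) (X i ω)) ∂P) Filter.atTop
      (nhds (∑' k, ∫⁻ ω, F (X k ω) *
        expNeg (∑' i, if i = k then 0 else f (X k ω) (X i ω)) ∂P)) := by
    -- The sum over `k` is treated as an integral for the counting measure. Its dominating function
    -- `E[F(X k)]` has sum `∫ F dΛ` by Campbell's formula.
    simp_rw [← lintegral_count (α := ℕ)]
    refine tendsto_lintegral_of_dominated_convergence (fun k => ∫⁻ ω, F (X k ω) ∂P)
      (fun n => .of_discrete)
      (fun n => ae_of_all _ fun k => lintegral_mono fun ω =>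
        mul_le_of_le_one_right' (expNeg_le_one _))
      (by rwa [lintegral_count, hFX]) (ae_of_all _ fun k => ?_)
    simp_rw [lintegral_count]
    refine tendsto_lintegral_of_dominated_convergence (fun ω => F (X k ω)) (fun n => ?_)
      (fun n => ae_of_all _ fun ω => mul_le_of_le_one_right' (expNeg_le_one _)) (hFk k) ?_
    · refine (hF.comp (hX k)).mul (Measurable.tsum fun i => ?_).expNeg
      split_ifs
      · exact measurable_const
      · exact (hgm n).comp ((hX k).prodMk (hX i))
    · filter_upwards [hFXae k] with ω hω
      refine ENNReal.Tendsto.const_mul ((continuous_expNeg.tendsto _).comp ?_) (Or.inr hω)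
      refine ENNReal.tendsto_tsum_of_le_of_tendsto (fun n i => ?_) fun i => ?_
      · split_ifs
        · exact le_rfl
        · exact hle n _ _
      · split_ifs
        · exact tendsto_const_nhds
        · exact hlim _ _
  have hR : Filter.Tendsto (fun n => ∫⁻ x, F x *
      ∫⁻ ω, expNeg (∑' i, g n (code n x) (X i ω)) ∂P ∂Λ) Filter.atTop
      (nhds (∫⁻ x, F x * ∫⁻ ω, expNeg (∑' i, f x (X i ω)) ∂P ∂Λ)) := by
    have hXm : ∀ n, Measurable fun p : S × Ω => expNeg (∑' i, g n (code n p.1) (X i p.2)) :=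
      fun n => (Measurable.tsum fun i => (hgm n).comp
        (measurable_fst.prodMk ((hX i).comp measurable_snd))).expNeg
    refine tendsto_lintegral_of_dominated_convergence F
      (fun n => hF.mul (hXm n).lintegral_prod_right')
      (fun n => ae_of_all _ fun x => mul_le_of_le_one_right' ?_) hFtop ?_
    · refine (lintegral_mono fun ω => expNeg_le_one _).trans ?_
      simp
    · filter_upwards [hFae] with x hx
      refine ENNReal.Tendsto.const_mul ?_ (Or.inr hx)
      refine tendsto_lintegral_of_dominated_convergence (fun _ => 1)
        (fun n => (hXm n).comp measurable_prodMk_left)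
        (fun n => ae_of_all _ fun ω => expNeg_le_one _) (by simp) (ae_of_all _ fun ω => ?_)
      exact (continuous_expNeg.tendsto _).comp
        (ENNReal.tendsto_tsum_of_le_of_tendsto (fun n i => hle n _ _) fun i => hlim _ _)
  refine tendsto_nhds_unique hL (hR.congr fun n => ?_)
  exact (h.mecke_of_countable hX (hcode n) (hg n) (hgtop n) hF).symm

/-- The Mecke formula for functionals `F x * exp (- ∑ z, u (dist (x + o) z))`. -/
theorem mecke_dist {S : Type*} [NormedAddCommGroup S] [MeasurableSpace S] [BorelSpace S]
    [SecondCountableTopology S] {Λ : Measure S} [SigmaFinite Λ] {X : ℕ → Ω → S}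
    (hX : ∀ k, Measurable (X k))
    (h : IsPoissonPointProcess P Λ fun ω => Measure.sum fun k => Measure.dirac (X k ω))
    {u : ℝ → ℝ≥0∞} (hu : Continuous u) (hanti : Antitone u) (hutop : ∀ r, 0 < r → u r ≠ ∞)
    (o : S) {F : S → ℝ≥0∞} (hF : Measurable F) (hFtop : ∫⁻ x, F x ∂Λ ≠ ∞) :
    ∑' k, ∫⁻ ω, F (X k ω) *
        expNeg (∑' i, if i = k then 0 else u (dist (X k ω + o) (X i ω))) ∂P
      = ∫⁻ x, F x * ∫⁻ ω, expNeg (∑' i, u (dist (x + o) (X i ω))) ∂P ∂Λ := by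
  classical
  let d := TopologicalSpace.denseSeq S
  have hd : ∀ (n : ℕ) (x : S), ∃ j, dist x (d j) < 1 / ((n : ℝ) + 1) := by
    intro n x
    obtain ⟨y, hy, j, rfl⟩ := Metric.dense_iff.1 (TopologicalSpace.denseRange_denseSeq S) x
      (1 / ((n : ℝ) + 1)) (by positivity)
    exact ⟨j, by rwa [dist_comm]⟩
  -- The selected point is replaced by the first point of a dense sequence within `1/(n+1)` of it.
  let code : ℕ → S → ℕ := fun n x => Nat.find (hd n x)
  have hcode : ∀ n x, dist x (d (code n x)) < 1 / ((n : ℝ) + 1) := fun n x => Nat.find_spec (hd n x)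
  have hcm : ∀ n, Measurable (code n) := fun n =>
    measurable_find _ fun j => measurableSet_lt (measurable_id.dist measurable_const) measurable_const
  have hup : ∀ n x z, dist (x + o) z ≤ dist (d (code n x) + o) z + 1 / ((n : ℝ) + 1) := by
    intro n x z
    have h1 := dist_triangle (x + o) (d (code n x) + o) z
    rw [dist_add_right] at h1
    linarith [hcode n x]
  have hlow : ∀ n x z, dist (d (code n x) + o) z ≤ dist (x + o) z + 1 / ((n : ℝ) + 1) := by
    intro n x z
    have h1 := dist_triangle (d (code n x) + o) (x + o) z
    rw [dist_add_right, dist_comm (d _) x] at h1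
    linarith [hcode n x]
  -- Adding `1/(n+1)` to the distance serves twice: since `u` is antitone the approximation stays
  -- below `u (dist (x + o) z)`, and since the argument is positive it is finite even if `u 0 = ∞`.
  refine h.mecke_of_tendsto hX hcm
    (g := fun n j z => u (dist (d j + o) z + 1 / ((n : ℝ) + 1)))
    (f := fun x z => u (dist (x + o) z)) (fun n j => ?_) (fun n j z => ?_)
    (fun n x z => hanti (hup n x z)) (fun x z => ?_) hF hFtop
  · exact hu.measurable.comp ((measurable_const.dist measurable_id).add measurable_const)
  · exact hutop _ (by positivity)
  · refine (hu.tendsto _).comp ?_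
    have hz := tendsto_one_div_add_atTop_nhds_zero_nat (𝕜 := ℝ)
    refine tendsto_of_tendsto_of_tendsto_of_le_of_le tendsto_const_nhds
      (h := fun n : ℕ => dist (x + o) z + (1 / ((n : ℝ) + 1) + 1 / ((n : ℝ) + 1))) ?_
      (fun n => hup n x z) (fun n => ?_)
    · simpa using (hz.add hz).const_add (dist (x + o) z)
    · have := hlow n x z
      simp only
      linarith

end IsPoissonPointProcess

/-! ### The radial integral -/

/-- The known integral over `ℂ`, carried to the plane by a measure preserving linear isometry. -/
lemma lintegral_exp_neg_mul_norm_rpow {α t : ℝ} (hα : 1 ≤ α) (ht : 0 < t) :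
    ∫⁻ z : Plane, ENNReal.ofReal (Real.exp (-t * ‖z‖ ^ α))
      = ENNReal.ofReal (Real.pi * t ^ (-2 / α) * Real.Gamma (2 / α + 1)) := by
  have h1 := Complex.orthonormalBasisOneI.measurePreserving_repr.lintegral_comp_emb
    Complex.orthonormalBasisOneI.repr.toHomeomorph.measurableEmbedding
    (fun z => ENNReal.ofReal (Real.exp (-t * ‖z‖ ^ α)))
  simp_rw [LinearIsometryEquiv.norm_map] at h1
  have h2 := Complex.integral_exp_neg_mul_rpow hα ht
  have hpos : 0 < Real.pi * t ^ (-2 / α) * Real.Gamma (2 / α + 1) :=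
    mul_pos (mul_pos Real.pi_pos (Real.rpow_pos_of_pos ht _)) (Real.Gamma_pos_of_pos (by positivity))
  have hi : Integrable fun x : ℂ => Real.exp (-t * ‖x‖ ^ α) := by
    -- The Bochner integral of a non-integrable function is `0`, so a positive value forces
    -- integrability.
    by_contra hi
    rw [integral_undef hi] at h2
    exact hpos.ne h2
  rw [← h1, ← ofReal_integral_eq_lintegral_ofReal hi (ae_of_all _ fun x => (Real.exp_pos _).le), h2]

/-- Euler's reflection formula. `Real.sinc` is the unnormalised `sin y / y`, hence the argument `π
x`. -/
lemma pi_div_sinc {x : ℝ} (h0 : 0 < x) :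
    Real.pi * Real.Gamma (x + 1) * Real.Gamma (1 - x) = Real.pi / Real.sinc (Real.pi * x) := by
  rw [Real.sinc_of_ne_zero (mul_pos Real.pi_pos h0).ne', Real.Gamma_add_one h0.ne', mul_assoc,
    mul_assoc x, Real.Gamma_mul_Gamma_one_sub, div_div_eq_mul_div]
  ring

lemma lintegral_mul_exp_neg_rpow {a c : ℝ} (ha : 0 < a) (hc : 0 < c) :
    ∫⁻ t in Set.Ioi 0, ENNReal.ofReal (t ^ (a - 1) * Real.exp (-(c * t)))
      = ENNReal.ofReal ((1 / c) ^ a * Real.Gamma a) := by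
  have h := Real.integral_rpow_mul_exp_neg_mul_Ioi ha hc
  have hpos : 0 < (1 / c) ^ a * Real.Gamma a :=
    mul_pos (Real.rpow_pos_of_pos (by positivity) _) (Real.Gamma_pos_of_pos ha)
  have hi : IntegrableOn (fun t => t ^ (a - 1) * Real.exp (-(c * t))) (Set.Ioi 0) := by
    by_contra hi
    rw [integral_undef hi] at h
    exact hpos.ne h
  rw [← ofReal_integral_eq_lintegral_ofReal hi, h]
  filter_upwards [ae_restrict_mem measurableSet_Ioi] with t ht
  exact mul_nonneg (Real.rpow_nonneg (le_of_lt ht) _) (Real.exp_pos _).le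

/-- The left side equals `c/(c + r^α)`, and `1/(c + r^α)` is the integral of `exp(-(c + r^α)t)`.
This separates `r` from `c` under the integral over `t`. -/
lemma one_sub_inv_one_add_mul_rpow {α c r : ℝ} (hc : 0 < c) (hr : 0 < r) :
    1 - (1 + ENNReal.ofReal c * ENNReal.ofReal r ^ (-α))⁻¹
      = ∫⁻ t in Set.Ioi 0, ENNReal.ofReal (c * Real.exp (-(c * t))) *
        ENNReal.ofReal (Real.exp (-t * r ^ α)) := by
  have hrα : 0 < r ^ α := Real.rpow_pos_of_pos hr _
  have h1 : ∀ t : ℝ, ENNReal.ofReal (c * Real.exp (-(c * t))) *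
      ENNReal.ofReal (Real.exp (-t * r ^ α))
      = ENNReal.ofReal c * ENNReal.ofReal (Real.exp (-((c + r ^ α) * t))) := by
    intro t
    rw [← ENNReal.ofReal_mul (by positivity), ← ENNReal.ofReal_mul hc.le, mul_assoc,
      ← Real.exp_add]
    congr 3; ring
  simp_rw [h1]
  rw [lintegral_const_mul _ (by fun_prop), lintegral_exp_neg_mul_Ioi (by positivity),
    ENNReal.ofReal_rpow_of_pos hr, ← ENNReal.ofReal_mul hc.le, ← ENNReal.ofReal_mul hc.le,
    ← ENNReal.ofReal_one, ← ENNReal.ofReal_add zero_le_one (by positivity),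
    ← ENNReal.ofReal_inv_of_pos (by positivity), ← ENNReal.ofReal_sub _ (by positivity)]
  congr 1
  rw [Real.rpow_neg hr.le]
  simp only [mul_zero, neg_zero, Real.exp_zero]
  field_simp
  ring

/-- The integral governing the Laplace functional of the interference under Rayleigh fading. -/
theorem lintegral_one_sub_inv_one_add_mul_rpow {α : ℝ} (hα : 2 < α) {c : ℝ} (hc : 0 ≤ c) :
    ∫⁻ z : Plane, (1 - (1 + ENNReal.ofReal c * ENNReal.ofReal ‖z‖ ^ (-α))⁻¹)
      = ENNReal.ofReal (c ^ (2 / α) * (Real.pi / Real.sinc (Real.pi * (2 / α)))) := by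
  have hx0 : 0 < 2 / α := by positivity
  have hx1 : 2 / α < 1 := by rw [div_lt_one (by linarith)]; exact hα
  rcases hc.eq_or_lt with rfl | hc
  · simp [Real.zero_rpow hx0.ne']
  have h0 : ∀ᵐ z : Plane, z ≠ 0 := by
    simp [ae_iff]
  have h1 : ∫⁻ z : Plane, (1 - (1 + ENNReal.ofReal c * ENNReal.ofReal ‖z‖ ^ (-α))⁻¹)
      = ∫⁻ z : Plane, ∫⁻ t in Set.Ioi (0 : ℝ), ENNReal.ofReal (c * Real.exp (-(c * t))) *
        ENNReal.ofReal (Real.exp (-t * ‖z‖ ^ α)) := by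
    refine lintegral_congr_ae ?_
    filter_upwards [h0] with z hz
    exact one_sub_inv_one_add_mul_rpow hc (norm_pos_iff.2 hz)
  rw [h1, lintegral_lintegral_swap (by fun_prop)]
  -- After Tonelli the planar integral yields `t^(-2/α)`; what remains is a Gamma integral with
  -- parameter `1 - 2/α`, positive because `α > 2`.
  have h2 : ∀ t ∈ Set.Ioi (0 : ℝ), ∫⁻ z : Plane, ENNReal.ofReal (c * Real.exp (-(c * t))) *
        ENNReal.ofReal (Real.exp (-t * ‖z‖ ^ α))
      = ENNReal.ofReal (c * (Real.pi * Real.Gamma (2 / α + 1))) *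
        ENNReal.ofReal (t ^ ((1 - 2 / α) - 1) * Real.exp (-(c * t))) := by
    intro t ht
    have hG : 0 < Real.Gamma (2 / α + 1) := Real.Gamma_pos_of_pos (by positivity)
    rw [lintegral_const_mul _ (by fun_prop), lintegral_exp_neg_mul_norm_rpow (by linarith) ht,
      ← ENNReal.ofReal_mul (by positivity), ← ENNReal.ofReal_mul (by positivity)]
    congr 1
    rw [show -2 / α = 1 - 2 / α - 1 by ring]
    ring
  rw [setLIntegral_congr_fun measurableSet_Ioi h2, lintegral_const_mul _ (by fun_prop),
    lintegral_mul_exp_neg_rpow (by linarith) hc, ← pi_div_sinc hx0,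
    ← ENNReal.ofReal_mul (mul_nonneg hc.le (mul_nonneg Real.pi_pos.le
      (Real.Gamma_pos_of_pos (by positivity)).le))]
  congr 1
  have h3 : c * (1 / c) ^ (1 - 2 / α) = c ^ (2 / α) := by
    rw [one_div, Real.inv_rpow hc.le, ← Real.rpow_neg hc.le]
    nth_rewrite 1 [← Real.rpow_one c]
    rw [← Real.rpow_add hc]
    congr 1; ring
  rw [← h3]
  ring

/-! ### Independence of the sources of randomness -/

/-- Averaging out an independent exponential variable in a Laplace transform. -/
lemma lintegral_expNeg_mul_exponential {Ω : Type*} [MeasurableSpace Ω] {P : Measure Ω}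
    [IsProbabilityMeasure P] {U : Ω → ℝ≥0∞} {H : Ω → ℝ} (hU : Measurable U) (hH : Measurable H)
    (h : IndepFun U H P) (hlaw : P.map H = expMeasure 1) :
    ∫⁻ ω, expNeg (U ω * ENNReal.ofReal (H ω)) ∂P = ∫⁻ ω, (1 + U ω)⁻¹ ∂P := by
  rw [lintegral_comp_of_indepFun hU hH h (G := fun u x => expNeg (u * ENNReal.ofReal x))
    (by unfold Function.uncurry; fun_prop)]
  refine lintegral_congr fun ω => ?_
  rw [← lintegral_expNeg_expMeasure_one, ← hlaw, lintegral_map (by fun_prop) hH]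

/-- Averaging out an independent exponential variable that has to exceed a random level. -/
lemma lintegral_indicator_exponential {Ω : Type*} [MeasurableSpace Ω] {P : Measure Ω}
    [IsProbabilityMeasure P] {A T : Ω → ℝ≥0∞} {H : Ω → ℝ} (hA : Measurable A) (hT : Measurable T)
    (hH : Measurable H) (h : IndepFun (fun ω => (A ω, T ω)) H P)
    (hlaw : P.map H = expMeasure 1) :
    ∫⁻ ω, A ω * {ω | T ω ≤ ENNReal.ofReal (H ω)}.indicator 1 ω ∂P
      = ∫⁻ ω, A ω * expNeg (T ω) ∂P := by
  have hm : ∀ t : ℝ≥0∞, MeasurableSet {x : ℝ | t ≤ ENNReal.ofReal x} := fun t =>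
    measurableSet_le measurable_const ENNReal.measurable_ofReal
  have hm2 : MeasurableSet {z : (ℝ≥0∞ × ℝ≥0∞) × ℝ | z.1.2 ≤ ENNReal.ofReal z.2} :=
    measurableSet_le (by fun_prop) (by fun_prop)
  have h1 := lintegral_comp_of_indepFun (hA.prodMk hT) hH h
    (G := fun u x => u.1 * {z : (ℝ≥0∞ × ℝ≥0∞) × ℝ | z.1.2 ≤ ENNReal.ofReal z.2}.indicator 1 (u, x))
    ((by fun_prop : Measurable fun z : (ℝ≥0∞ × ℝ≥0∞) × ℝ => z.1.1).mul
      (measurable_one.indicator hm2))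
  refine Eq.trans (lintegral_congr fun ω => ?_) (h1.trans (lintegral_congr fun ω => ?_))
  · rfl
  · have hmω : Measurable fun ω' =>
        {z : (ℝ≥0∞ × ℝ≥0∞) × ℝ | z.1.2 ≤ ENNReal.ofReal z.2}.indicator (1 : (ℝ≥0∞ × ℝ≥0∞) × ℝ → ℝ≥0∞)
          ((A ω, T ω), H ω') :=
      (measurable_one.indicator hm2).comp (measurable_prodMk_left.comp hH)
    rw [lintegral_const_mul _ hmω,
      ← expMeasure_one_tail, ← hlaw, Measure.map_apply hH (hm _), ← lintegral_indicator_one (hH (hm _))]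
    rfl

namespace D2DNetwork

variable {Ω : Type*} {M : ℕ} {N : D2DNetwork Ω M}

/-- The information carried by a set of sources of randomness. -/
@[reducible] noncomputable def groupAlg (N : D2DNetwork Ω M) (S : Set (Source M)) :
    MeasurableSpace Ω :=
  ⨆ i ∈ S, N.sigmaAlg i

lemma sigmaAlg_le_groupAlg (N : D2DNetwork Ω M) {S : Set (Source M)} {i : Source M} (hi : i ∈ S) :
    N.sigmaAlg i ≤ N.groupAlg S :=
  le_iSup₂_of_le i hi le_rfl

lemma measurable_tx_groupAlg {S : Set (Source M)} (h : Source.positions ∈ S) (k : ℕ) :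
    Measurable[N.groupAlg S] (N.tx k) :=
  ((comap_measurable (N.tx k)).mono (le_iSup (fun k => MeasurableSpace.comap (N.tx k) inferInstance) k)
    le_rfl).mono (N.sigmaAlg_le_groupAlg h) le_rfl

lemma measurable_mark_groupAlg {S : Set (Source M)} {k : ℕ} (h : Source.mark k ∈ S) :
    Measurable[N.groupAlg S] fun ω => (N.offset k ω, N.power k ω) :=
  (comap_measurable _).mono (N.sigmaAlg_le_groupAlg h) le_rfl

lemma measurable_offset_groupAlg {S : Set (Source M)} {k : ℕ} (h : Source.mark k ∈ S) :
    Measurable[N.groupAlg S] (N.offset k) :=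
  measurable_fst.comp (measurable_mark_groupAlg h)

lemma measurable_power_groupAlg {S : Set (Source M)} {k : ℕ} (h : Source.mark k ∈ S) :
    Measurable[N.groupAlg S] (N.power k) :=
  measurable_snd.comp (measurable_mark_groupAlg h)

lemma measurable_label_groupAlg {S : Set (Source M)} {k : ℕ} (h : Source.label k ∈ S) :
    Measurable[N.groupAlg S] (N.label k) :=
  (comap_measurable _).mono (N.sigmaAlg_le_groupAlg h) le_rfl

lemma measurable_cue_groupAlg {S : Set (Source M)} {m : Fin M} (h : Source.cue m ∈ S) :
    Measurable[N.groupAlg S] (N.cue m) :=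
  (comap_measurable _).mono (N.sigmaAlg_le_groupAlg h) le_rfl

lemma measurable_cuePower_groupAlg {S : Set (Source M)} (h : Source.cuePower ∈ S) :
    Measurable[N.groupAlg S] N.cuePower :=
  (comap_measurable _).mono (N.sigmaAlg_le_groupAlg h) le_rfl

lemma measurable_gain_groupAlg {S : Set (Source M)} {k l : ℕ} (h : Source.gain k l ∈ S) :
    Measurable[N.groupAlg S] (N.gain k l) :=
  (comap_measurable _).mono (N.sigmaAlg_le_groupAlg h) le_rfl

lemma measurable_cueGain_groupAlg {S : Set (Source M)} {k : ℕ} {m : Fin M}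
    (h : Source.cueGain k m ∈ S) : Measurable[N.groupAlg S] (N.cueGain k m) :=
  (comap_measurable _).mono (N.sigmaAlg_le_groupAlg h) le_rfl

lemma measurable_rxPower (N : D2DNetwork Ω M) {X : Type*} {mX : MeasurableSpace X} {p d : X → ℝ}
    {h : X → ℂ}
    (hp : Measurable p) (hh : Measurable h) (hd : Measurable d) :
    Measurable fun x => N.rxPower (p x) (h x) (d x) := by
  unfold rxPower
  fun_prop

variable [MeasurableSpace Ω] {P : Measure Ω}

lemma IsModel.sigmaAlg_le (hN : N.IsModel P) (i : Source M) : N.sigmaAlg i ≤ ‹MeasurableSpace Ω› := by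
  cases i with
  | positions => exact iSup_le fun k => (hN.measurable_tx k).comap_le
  | mark k => exact ((hN.measurable_offset k).prodMk (hN.measurable_power k)).comap_le
  | label k => exact (hN.measurable_label k).comap_le
  | cue m => exact (hN.measurable_cue m).comap_le
  | cuePower => exact hN.measurable_cuePower.comap_le
  | gain k l => exact (hN.measurable_gain k l).comap_le
  | cueGain k m => exact (hN.measurable_cueGain k m).comap_le

lemma IsModel.groupAlg_le (hN : N.IsModel P) (S : Set (Source M)) :
    N.groupAlg S ≤ ‹MeasurableSpace Ω› :=
  iSup₂_le fun i _ => hN.sigmaAlg_le i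

lemma IsModel.indep_groupAlg (hN : N.IsModel P) {S T : Set (Source M)} (h : Disjoint S T) :
    Indep (N.groupAlg S) (N.groupAlg T) P :=
  indep_iSup_of_disjoint hN.sigmaAlg_le hN.indep h

/-- The independence statements about random variables used for the coverage formula are obtained
this way, by listing the sources each variable depends on and checking that the lists are disjoint.
-/
lemma IsModel.indepFun (hN : N.IsModel P) {E F : Type*} [mE : MeasurableSpace E]
    [mF : MeasurableSpace F] {S T : Set (Source M)} {U : Ω → E} {V : Ω → F}
    (hU : Measurable[N.groupAlg S] U) (hV : Measurable[N.groupAlg T] V) (h : Disjoint S T) :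
    IndepFun U V P :=
  indep_of_indep_of_le_right (indep_of_indep_of_le_left (hN.indep_groupAlg h) hU.comap_le)
    hV.comap_le

lemma IsModel.lintegral_mul (hN : N.IsModel P) {S T : Set (Source M)} {U V : Ω → ℝ≥0∞}
    (hU : Measurable[N.groupAlg S] U) (hV : Measurable[N.groupAlg T] V) (h : Disjoint S T) :
    ∫⁻ ω, U ω * V ω ∂P = (∫⁻ ω, U ω ∂P) * ∫⁻ ω, V ω ∂P :=
  lintegral_mul_eq_lintegral_mul_lintegral_of_independent_measurableSpace
    (hN.groupAlg_le S) (hN.groupAlg_le T) (hN.indep_groupAlg h) hU hV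

/-! ### The interference of the other links -/

/-- For a link of length `r`, the Laplace transform at `s` of the received power differs from one
by this quantity. -/
noncomputable def fadingLoss (N : D2DNetwork Ω M) (P : Measure Ω) (k : ℕ) (s r : ℝ) : ℝ≥0∞ :=
  ∫⁻ ω, (1 - (1 + ENNReal.ofReal s * ENNReal.ofReal (N.power k ω) * ENNReal.ofReal r ^ (-N.α))⁻¹) ∂P

/-- The Laplace transform at `s` of the interference from a D2D transmitter at distance `r`, which
may or may not share the resource of the `m`-th cellular user. -/
noncomputable def linkTransform (N : D2DNetwork Ω M) (P : Measure Ω) (m : Fin M) (k : ℕ)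
    (s r : ℝ) : ℝ≥0∞ :=
  1 - P {ω | N.label k ω = m} * N.fadingLoss P k s r

/-- The Laplace transform at `s` of the interference from the `m`-th cellular user, for a receiver
at the point `y`. -/
noncomputable def cueTransform (N : D2DNetwork Ω M) (P : Measure Ω) (m : Fin M) (y : Plane)
    (s : ℝ) : ℝ≥0∞ :=
  ∫⁻ ω, (1 + ENNReal.ofReal s *
    (ENNReal.ofReal (N.cuePower ω) * ENNReal.ofReal (dist y (N.cue m ω)) ^ (-N.α)))⁻¹ ∂P

lemma linkTransform_le_one (m : Fin M) (k : ℕ) (s r : ℝ) : N.linkTransform P m k s r ≤ 1 :=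
  tsub_le_self

lemma measurable_label_eq (hN : N.IsModel P) (k : ℕ) (m : Fin M) :
    MeasurableSet {ω | N.label k ω = m} :=
  hN.measurable_label k (MeasurableSpace.measurableSet_top (s := {m}))

lemma lintegral_comp_mark_eq (hN : N.IsModel P) (i k : ℕ) {u : Plane × ℝ → ℝ≥0∞}
    (hu : Measurable u) :
    ∫⁻ ω, u (N.offset i ω, N.power i ω) ∂P = ∫⁻ ω, u (N.offset k ω, N.power k ω) ∂P :=
  ((hN.mark_ident i k).comp hu).lintegral_eq

lemma lintegral_comp_power_eq (hN : N.IsModel P) (i k : ℕ) {u : ℝ → ℝ≥0∞} (hu : Measurable u) :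
    ∫⁻ ω, u (N.power i ω) ∂P = ∫⁻ ω, u (N.power k ω) ∂P :=
  lintegral_comp_mark_eq hN i k (u := fun z => u z.2) (hu.comp measurable_snd)

section

variable [IsProbabilityMeasure P]

lemma lintegral_one_sub_eq (f : Ω → ℝ≥0∞) (hf : Measurable f) (h1 : ∀ ω, f ω ≤ 1) :
    ∫⁻ ω, (1 - f ω) ∂P = 1 - ∫⁻ ω, f ω ∂P := by
  rw [lintegral_sub hf _ (ae_of_all _ h1)]
  · simp
  · refine ne_top_of_le_ne_top ENNReal.one_ne_top ((lintegral_mono h1).trans ?_)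
    simp

lemma fadingLoss_le_one (k : ℕ) (s r : ℝ) : N.fadingLoss P k s r ≤ 1 := by
  refine (lintegral_mono fun ω => tsub_le_self).trans ?_
  simp

/-- The gain is averaged out first, then the power. Powers are identically distributed, so the
result can be expressed through one reference link `k₀`, the same for all `i`. -/
lemma lintegral_expNeg_rxPower (hN : N.IsModel P) (k₀ k i : ℕ) (s r : ℝ) :
    ∫⁻ ω, expNeg (ENNReal.ofReal s * N.rxPower (N.power i ω) (N.gain k i ω) r) ∂P
      = 1 - N.fadingLoss P k₀ s r := by
  have hd : ∀ {m' : MeasurableSpace Ω}, Measurable[m'] (N.power i) →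
      Measurable[m'] fun ω => ENNReal.ofReal s * ENNReal.ofReal (N.power i ω) *
        ENNReal.ofReal r ^ (-N.α) := by
    intro m' h1
    fun_prop
  have hind : IndepFun (fun ω => ENNReal.ofReal s * ENNReal.ofReal (N.power i ω) *
      ENNReal.ofReal r ^ (-N.α)) (fun ω => ‖N.gain k i ω‖ ^ 2) P := by
    refine hN.indepFun (S := {Source.mark i}) (T := {Source.gain k i})
      (hd (measurable_power_groupAlg (Set.mem_singleton _))) ?_ (by simp)
    have := measurable_gain_groupAlg (N := N) (Set.mem_singleton (Source.gain k i))
    exact (by fun_prop : Measurable fun z : ℂ => ‖z‖ ^ 2).comp this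
  have h1 := lintegral_expNeg_mul_exponential (hd (hN.measurable_power i))
    ((hN.measurable_gain k i).norm.pow_const 2) hind (hN.gain_law k i)
  have h2 := lintegral_comp_power_eq hN i k₀ (u := fun p => (1 + ENNReal.ofReal s *
    ENNReal.ofReal p * ENNReal.ofReal r ^ (-N.α))⁻¹) (by fun_prop)
  have hp := hN.measurable_power k₀
  have hle : ∀ ω, (1 + ENNReal.ofReal s * ENNReal.ofReal (N.power k₀ ω) *
      ENNReal.ofReal r ^ (-N.α))⁻¹ ≤ 1 := fun ω => ENNReal.inv_le_one.2 le_self_add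
  rw [fadingLoss, lintegral_one_sub_eq _ (by fun_prop) hle,
    ENNReal.sub_sub_cancel ENNReal.one_ne_top ((lintegral_mono hle).trans (by simp)), ← h2, ← h1]
  refine lintegral_congr fun ω => ?_
  rw [rxPower]
  congr 1
  ring

/-- The complement `1 - exp(-·)` vanishes unless the label is `m`, so independent thinning
multiplies the loss by the label probability. -/
lemma lintegral_expNeg_link (hN : N.IsModel P) (m : Fin M) (k₀ k i : ℕ) (s r : ℝ) :
    ∫⁻ ω, expNeg (if N.label i ω = m then
      ENNReal.ofReal s * N.rxPower (N.power i ω) (N.gain k i ω) r else 0) ∂P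
      = N.linkTransform P m k₀ s r := by
  have hs := measurable_label_eq hN i m
  have hg : Measurable fun ω => N.rxPower (N.power i ω) (N.gain k i ω) r :=
    N.measurable_rxPower (hN.measurable_power i) (hN.measurable_gain k i) measurable_const
  have hf : Measurable fun ω => expNeg (if N.label i ω = m then
      ENNReal.ofReal s * N.rxPower (N.power i ω) (N.gain k i ω) r else 0) :=
    (Measurable.ite hs (hg.const_mul _) measurable_const).expNeg
  have h1 : ∀ ω, 1 - expNeg (if N.label i ω = m then
      ENNReal.ofReal s * N.rxPower (N.power i ω) (N.gain k i ω) r else 0)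
      = {ω | N.label i ω = m}.indicator 1 ω *
        (1 - expNeg (ENNReal.ofReal s * N.rxPower (N.power i ω) (N.gain k i ω) r)) := by
    intro ω
    by_cases h : N.label i ω = m <;> simp [h]
  have hU : Measurable[N.groupAlg {Source.label i}]
      ({ω | N.label i ω = m}.indicator (1 : Ω → ℝ≥0∞)) :=
    Measurable.indicator measurable_const
      (measurable_label_groupAlg (N := N) (Set.mem_singleton (Source.label i))
        (measurableSet_singleton m))
  have hV : Measurable[N.groupAlg {Source.mark i, Source.gain k i}] fun ω =>
      1 - expNeg (ENNReal.ofReal s * N.rxPower (N.power i ω) (N.gain k i ω) r) :=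
    (by fun_prop : Measurable fun x => 1 - expNeg (ENNReal.ofReal s * x)).comp
      (N.measurable_rxPower (measurable_power_groupAlg (Set.mem_insert _ _))
        (measurable_gain_groupAlg (Set.mem_insert_of_mem _ (Set.mem_singleton _)))
        measurable_const)
  have h5 := lintegral_one_sub_eq (P := P) _ hf fun ω => expNeg_le_one _
  simp_rw [h1] at h5
  rw [hN.lintegral_mul hU hV (by simp), lintegral_indicator_one hs, hN.label_ident i k₀ m,
    lintegral_one_sub_eq _ (hg.const_mul _).expNeg fun ω => expNeg_le_one _,
    lintegral_expNeg_rxPower hN k₀, ENNReal.sub_sub_cancel ENNReal.one_ne_top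
    (fadingLoss_le_one _ _ _)] at h5
  rw [linkTransform, h5, ENNReal.sub_sub_cancel ENNReal.one_ne_top]
  refine (lintegral_mono fun ω => expNeg_le_one _).trans ?_
  simp

lemma lintegral_expNeg_cue (hN : N.IsModel P) (m : Fin M) (k : ℕ) (s : ℝ) (y : Plane) :
    ∫⁻ ω, expNeg (ENNReal.ofReal s *
      N.rxPower (N.cuePower ω) (N.cueGain k m ω) (dist y (N.cue m ω))) ∂P
      = N.cueTransform P m y s := by
  have hd : ∀ {m' : MeasurableSpace Ω}, Measurable[m'] N.cuePower → Measurable[m'] (N.cue m) →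
      Measurable[m'] fun ω => ENNReal.ofReal s *
        (ENNReal.ofReal (N.cuePower ω) * ENNReal.ofReal (dist y (N.cue m ω)) ^ (-N.α)) := by
    intro m' h1 h2
    fun_prop
  have hind : IndepFun (fun ω => ENNReal.ofReal s *
        (ENNReal.ofReal (N.cuePower ω) * ENNReal.ofReal (dist y (N.cue m ω)) ^ (-N.α)))
        (fun ω => ‖N.cueGain k m ω‖ ^ 2) P := by
    refine hN.indepFun (S := {Source.cuePower, Source.cue m}) (T := {Source.cueGain k m})
      (hd (measurable_cuePower_groupAlg (by simp)) (measurable_cue_groupAlg (by simp))) ?_ (by simp)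
    have := measurable_cueGain_groupAlg (N := N) (Set.mem_singleton (Source.cueGain k m))
    exact (by fun_prop : Measurable fun z : ℂ => ‖z‖ ^ 2).comp this
  rw [cueTransform, ← lintegral_expNeg_mul_exponential
      (hd hN.measurable_cuePower (hN.measurable_cue m))
      ((hN.measurable_cueGain k m).norm.pow_const 2) hind (hN.cueGain_law k m)]
  refine lintegral_congr fun ω => ?_
  rw [rxPower]
  congr 1
  ring

end

end D2DNetwork

/-! ### Which sources each quantity depends on, and the interference for frozen positions -/

namespace D2DNetwork

variable {Ω : Type*} {M : ℕ} {N : D2DNetwork Ω M}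

lemma tsum_subtype_ne (k : ℕ) (f : ℕ → ℝ≥0∞) :
    ∑' i : {i : ℕ // i ≠ k}, f i = ∑' i, if i = k then 0 else f i := by
  refine (tsum_subtype {i | i ≠ k} f).trans (tsum_congr fun i => ?_)
  by_cases h : i = k <;> simp [h]

lemma d2dInterference_eq (m : Fin M) (k : ℕ) (ω : Ω) :
    N.d2dInterference m k ω = ∑' i : {i : ℕ // i ≠ k}, if N.label i ω = m then
      N.rxPower (N.power i ω) (N.gain k i ω) (dist (N.rx k ω) (N.tx i ω)) else 0 := by
  rw [tsum_subtype_ne k (fun i => if N.label i ω = m then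
      N.rxPower (N.power i ω) (N.gain k i ω) (dist (N.rx k ω) (N.tx i ω)) else 0)]
  refine (tsum_subtype {i | i ≠ k ∧ N.label i ω = m}
    (fun i => N.rxPower (N.power i ω) (N.gain k i ω) (dist (N.rx k ω) (N.tx i ω)))).trans
    (tsum_congr fun i => ?_)
  by_cases h : i = k <;> by_cases h' : N.label i ω = m <;> simp [h, h']

lemma linkDist_eq (k : ℕ) (ω : Ω) : N.linkDist k ω = ‖N.offset k ω‖ := by
  simp [linkDist, rx, dist_eq_norm]

/-- The received signal is nonzero and finite, so clearing the denominator is valid in `ℝ≥0∞` even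
if interference plus noise is `0` or `∞`. -/
lemma le_sinr_iff {m : Fin M} {k : ℕ} {ω : Ω} {β : ℝ} (hβ : 0 < β) (ho : N.offset k ω ≠ 0)
    (hp : 0 < N.power k ω) (hg : 0 < ‖N.gain k k ω‖ ^ 2) :
    ENNReal.ofReal β ≤ N.sinr m k ω ↔ ENNReal.ofReal (β * N.Z k ω) *
      (N.d2dInterference m k ω + N.cueInterference m k ω + ENNReal.ofReal (N.σ ^ 2))
      ≤ ENNReal.ofReal (‖N.gain k k ω‖ ^ 2) := by
  have hd : 0 < N.linkDist k ω := by rw [linkDist_eq]; exact norm_pos_iff.2 ho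
  have hdα : 0 < N.linkDist k ω ^ N.α := Real.rpow_pos_of_pos hd _
  set D := N.d2dInterference m k ω + N.cueInterference m k ω + ENNReal.ofReal (N.σ ^ 2)
  set c := ENNReal.ofReal (N.power k ω / N.linkDist k ω ^ N.α) with hc
  have hc0 : c ≠ 0 := by
    rw [hc, Ne, ENNReal.ofReal_eq_zero, not_le]; positivity
  have hx : N.rxPower (N.power k ω) (N.gain k k ω) (N.linkDist k ω)
      = c * ENNReal.ofReal (‖N.gain k k ω‖ ^ 2) := by
    rw [rxPower, mul_right_comm, ENNReal.ofReal_rpow_of_pos hd, ← ENNReal.ofReal_mul hp.le,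
      Real.rpow_neg hd.le, hc, div_eq_mul_inv]
  have hZ : ENNReal.ofReal β = c * ENNReal.ofReal (β * N.Z k ω) := by
    rw [hc, ← ENNReal.ofReal_mul (by positivity), Z]
    congr 1
    field_simp
  have hg0 : ENNReal.ofReal (‖N.gain k k ω‖ ^ 2) ≠ 0 := by
    rwa [Ne, ENNReal.ofReal_eq_zero, not_le]
  rw [sinr, hx, ENNReal.le_div_iff_mul_le (Or.inr (mul_ne_zero hc0 hg0))
    (Or.inr (ENNReal.mul_ne_top ENNReal.ofReal_ne_top ENNReal.ofReal_ne_top)), hZ, mul_assoc,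
    ENNReal.mul_le_mul_iff_right hc0 ENNReal.ofReal_ne_top]

lemma measurable_rx_groupAlg {S : Set (Source M)} {k : ℕ} (h : Source.positions ∈ S)
    (h' : Source.mark k ∈ S) : Measurable[N.groupAlg S] (N.rx k) :=
  measurable_add.comp ((measurable_tx_groupAlg h k).prodMk (measurable_offset_groupAlg h'))

lemma measurable_inGroup_indicator (m : Fin M) (k : ℕ) :
    Measurable[N.groupAlg {Source.gain k k}ᶜ] ((N.inGroup m k).indicator (1 : Ω → ℝ≥0∞)) := by
  refine Measurable.indicator measurable_const (MeasurableSet.inter ?_ ?_)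
  · exact measurable_label_groupAlg (N := N) (by simp) (measurableSet_singleton m)
  · exact measurable_rx_groupAlg (N := N) (by simp) (by simp) Metric.isClosed_closedBall.measurableSet

lemma measurable_tsum_rxPower (N : D2DNetwork Ω M) {X ι : Type*} {mX : MeasurableSpace X}
    [Countable ι] (m : Fin M) {l : ι → X → Fin M} {p d : ι → X → ℝ} {h : ι → X → ℂ}
    (hl : ∀ i, Measurable (l i)) (hp : ∀ i, Measurable (p i)) (hh : ∀ i, Measurable (h i))
    (hd : ∀ i, Measurable (d i)) :
    Measurable fun x => ∑' i, if l i x = m then N.rxPower (p i x) (h i x) (d i x) else 0 :=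
  Measurable.tsum fun i => Measurable.ite (hl i (measurableSet_singleton m))
    (N.measurable_rxPower (hp i) (hh i) (hd i)) measurable_const

lemma measurable_dist_comp {X : Type*} {mX : MeasurableSpace X} {u v : X → Plane}
    (hu : Measurable u) (hv : Measurable v) : Measurable fun x => dist (u x) (v x) :=
  hu.dist hv

lemma measurable_dist_rx_groupAlg {S : Set (Source M)} {k : ℕ} (h : Source.positions ∈ S)
    (h' : Source.mark k ∈ S) {u : Ω → Plane} (hu : Measurable[N.groupAlg S] u) :
    Measurable[N.groupAlg S] fun ω => dist (N.rx k ω) (u ω) :=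
  measurable_dist_comp (measurable_rx_groupAlg h h') hu

lemma measurable_Z_groupAlg {S : Set (Source M)} {k : ℕ} (h : Source.positions ∈ S)
    (h' : Source.mark k ∈ S) : Measurable[N.groupAlg S] (N.Z k) := by
  have hg : Measurable fun z : ℝ × ℝ => z.1 ^ N.α / z.2 := by fun_prop
  exact hg.comp ((measurable_dist_rx_groupAlg h h' (measurable_tx_groupAlg h k)).prodMk
    (measurable_power_groupAlg h'))

lemma measurable_cueInterference_groupAlg {S : Set (Source M)} {k : ℕ} {m : Fin M}
    (h : Source.positions ∈ S) (h' : Source.mark k ∈ S) (hp : Source.cuePower ∈ S)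
    (hc : Source.cue m ∈ S) (hg : Source.cueGain k m ∈ S) :
    Measurable[N.groupAlg S] (N.cueInterference m k) :=
  N.measurable_rxPower (measurable_cuePower_groupAlg hp) (measurable_cueGain_groupAlg hg)
    (measurable_dist_rx_groupAlg h h' (measurable_cue_groupAlg hc))

lemma measurable_d2dInterference_groupAlg {S : Set (Source M)} {k : ℕ} {m : Fin M}
    (h : Source.positions ∈ S) (hm : ∀ i, Source.mark i ∈ S) (hl : ∀ i, Source.label i ∈ S)
    (hg : ∀ i, i ≠ k → Source.gain k i ∈ S) :
    Measurable[N.groupAlg S] (N.d2dInterference m k) := by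
  have : N.d2dInterference m k = _ := funext fun ω => d2dInterference_eq m k ω
  rw [this]
  exact N.measurable_tsum_rxPower m (fun i => measurable_label_groupAlg (hl i))
    (fun i => measurable_power_groupAlg (hm i)) (fun i => measurable_gain_groupAlg (hg i i.2))
    (fun i => measurable_dist_rx_groupAlg h (hm k) (measurable_tx_groupAlg h i))

/-- The level that `|h_kk|²` must exceed involves every source except that gain, hence is
independent of it. -/
lemma measurable_level (m : Fin M) (k : ℕ) (β : ℝ) :
    Measurable[N.groupAlg {Source.gain k k}ᶜ] fun ω => ENNReal.ofReal (β * N.Z k ω) *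
      (N.d2dInterference m k ω + N.cueInterference m k ω + ENNReal.ofReal (N.σ ^ 2)) := by
  have hZ : Measurable[N.groupAlg {Source.gain k k}ᶜ] (N.Z k) :=
    measurable_Z_groupAlg (by simp) (by simp)
  have hC : Measurable[N.groupAlg {Source.gain k k}ᶜ] (N.cueInterference m k) :=
    measurable_cueInterference_groupAlg (by simp) (by simp) (by simp) (by simp) (by simp)
  have hI : Measurable[N.groupAlg {Source.gain k k}ᶜ] (N.d2dInterference m k) :=
    measurable_d2dInterference_groupAlg (by simp) (by simp) (by simp) (by simp)
  have hg : Measurable fun z : ℝ × ℝ≥0∞ × ℝ≥0∞ => ENNReal.ofReal (β * z.1) *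
    (z.2.1 + z.2.2 + ENNReal.ofReal (N.σ ^ 2)) := by fun_prop
  exact hg.comp (hZ.prodMk (hI.prodMk hC))

variable [MeasurableSpace Ω] {P : Measure Ω}

lemma measurable_fadingLoss [SFinite P] (hN : N.IsModel P) (k : ℕ) :
    Measurable fun z : ℝ × ℝ => N.fadingLoss P k z.1 z.2 := by
  have hp := hN.measurable_power k
  have h : Measurable fun z : (ℝ × ℝ) × Ω => 1 - (1 + ENNReal.ofReal z.1.1 *
    ENNReal.ofReal (N.power k z.2) * ENNReal.ofReal z.1.2 ^ (-N.α))⁻¹ := by fun_prop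
  exact h.lintegral_prod_right'

lemma measurable_linkTransform [SFinite P] (hN : N.IsModel P) (m : Fin M) (k : ℕ) :
    Measurable fun z : ℝ × ℝ => N.linkTransform P m k z.1 z.2 :=
  ((measurable_fadingLoss hN k).const_mul _).const_sub _

lemma measurable_cueTransform [SFinite P] (hN : N.IsModel P) (m : Fin M) :
    Measurable fun z : Plane × ℝ => N.cueTransform P m z.1 z.2 := by
  have hp := hN.measurable_cuePower
  have hc := hN.measurable_cue m
  have h : Measurable fun z : (Plane × ℝ) × Ω => (1 + ENNReal.ofReal z.1.2 *
    (ENNReal.ofReal (N.cuePower z.2) *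
      ENNReal.ofReal (dist z.1.1 (N.cue m z.2)) ^ (-N.α)))⁻¹ := by fun_prop
  exact h.lintegral_prod_right'

lemma IsModel.lintegral_prod [IsProbabilityMeasure P] (hN : N.IsModel P) {ι : Type*}
    (s : Finset ι) {S : ι → Set (Source M)} (hS : Pairwise fun i j => Disjoint (S i) (S j))
    {W : ι → Ω → ℝ≥0∞} (hW : ∀ i, Measurable[N.groupAlg (S i)] (W i)) :
    ∫⁻ ω, ∏ i ∈ s, W i ω ∂P = ∏ i ∈ s, ∫⁻ ω, W i ω ∂P := by
  classical
  induction s using Finset.induction_on with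
  | empty => simp
  | insert a s ha ih =>
    simp_rw [Finset.prod_insert ha]
    rw [← ih]
    refine hN.lintegral_mul (T := ⋃ i ∈ s, S i) (hW a) ?_ ?_
    · refine Finset.measurable_fun_prod s fun i hi => (hW i).mono ?_ le_rfl
      exact iSup₂_le fun x hx => N.sigmaAlg_le_groupAlg (Set.mem_biUnion hi hx)
    · simp only [Set.disjoint_iUnion_right]
      exact fun i hi => hS (fun h => ha (h ▸ hi))

/-- With positions frozen, the other links contribute independent factors. Their product is
rewritten as `exp` of minus a sum over points, the form required by the Mecke formula. -/
lemma lintegral_expNeg_interference [IsProbabilityMeasure P] (hN : N.IsModel P) (m : Fin M)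
    (k₀ k : ℕ) (s : ℝ) (y : Plane) (t : ℕ → Plane) :
    ∫⁻ ω, expNeg (ENNReal.ofReal s * ∑' i : {i : ℕ // i ≠ k}, if N.label i ω = m then
      N.rxPower (N.power i ω) (N.gain k i ω) (dist y (t i)) else 0) ∂P
      = expNeg (∑' i, if i = k then 0 else
        negLog (N.linkTransform P m k₀ s (dist y (t i)))) := by
  set J : ℕ → Ω → ℝ≥0∞ := fun i ω => if i = k then 0 else if N.label i ω = m then
    ENNReal.ofReal s * N.rxPower (N.power i ω) (N.gain k i ω) (dist y (t i)) else 0 with hJ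
  -- The receiver index `k` is fixed, so the sources used by different interferers `i` do not
  -- overlap.
  set S : ℕ → Set (Source M) := fun i => {Source.label i, Source.mark i, Source.gain k i} with hS
  have hSd : Pairwise fun i j => Disjoint (S i) (S j) := by
    intro i j hij
    simp [S, hij.symm]
  have hJm : ∀ i, Measurable[N.groupAlg (S i)] (J i) := by
    intro i
    by_cases hi : i = k
    · simp only [hJ, hi, if_true]
      exact measurable_const
    · simp only [hJ, hi, if_false]
      refine Measurable.ite ?_ ?_ measurable_const
      · exact measurable_label_groupAlg (N := N) (by simp [S]) (measurableSet_singleton m)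
      · exact (by fun_prop : Measurable fun x => ENNReal.ofReal s * x).comp
          (N.measurable_rxPower (measurable_power_groupAlg (by simp [S]))
            (measurable_gain_groupAlg (by simp [S])) measurable_const)
  have hJm' : ∀ i, Measurable (J i) := fun i => (hJm i).mono (hN.groupAlg_le _) le_rfl
  have h1 : ∀ i, ∫⁻ ω, expNeg (J i ω) ∂P = expNeg (if i = k then 0 else
      negLog (N.linkTransform P m k₀ s (dist y (t i)))) := by
    intro i
    by_cases hi : i = k
    · simp [hJ, hi]
    · simp only [hJ, hi, if_false]
      rw [lintegral_expNeg_link hN m k₀, expNeg_negLog (linkTransform_le_one _ _ _ _)]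
  have h2 : ∀ n : ℕ, ∫⁻ ω, ∏ i ∈ Finset.range n, expNeg (J i ω) ∂P
      = ∏ i ∈ Finset.range n, expNeg (if i = k then 0 else
      negLog (N.linkTransform P m k₀ s (dist y (t i)))) := by
    intro n
    refine (hN.lintegral_prod _ hSd fun i => measurable_expNeg.comp (hJm i)).trans ?_
    exact Finset.prod_congr rfl fun i _ => h1 i
  have h3 : ∀ ω, ENNReal.ofReal s * ∑' i : {i : ℕ // i ≠ k}, (if N.label i ω = m then
      N.rxPower (N.power i ω) (N.gain k i ω) (dist y (t i)) else 0) = ∑' i, J i ω := by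
    intro ω
    rw [tsum_subtype_ne k (fun i => if N.label i ω = m then
      N.rxPower (N.power i ω) (N.gain k i ω) (dist y (t i)) else 0), ← ENNReal.tsum_mul_left]
    refine tsum_congr fun i => ?_
    by_cases h : i = k <;> by_cases h' : N.label i ω = m <;> simp [hJ, h, h']
  simp_rw [h3]
  have h4 : Filter.Tendsto (fun n => ∫⁻ ω, ∏ i ∈ Finset.range n, expNeg (J i ω) ∂P) Filter.atTop
      (nhds (∫⁻ ω, expNeg (∑' i, J i ω) ∂P)) := by
    refine tendsto_lintegral_of_dominated_convergence (fun _ => 1)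
      (fun n => Finset.measurable_fun_prod _ fun i _ => (hJm' i).expNeg)
      (fun n => ae_of_all _ fun ω => Finset.prod_le_one' fun i _ => expNeg_le_one _) (by simp)
      (ae_of_all _ fun ω => ?_)
    exact (tendsto_prod_expNeg fun i => J i ω).comp Filter.tendsto_finset_range
  simp_rw [h2] at h4
  exact tendsto_nhds_unique h4 ((tendsto_prod_expNeg _).comp Filter.tendsto_finset_range)

/-! ### Averaging over the fading, given the positions and the mark of a link -/

lemma ae_offset_ne_zero (hN : N.IsModel P) (k : ℕ) : ∀ᵐ ω ∂P, N.offset k ω ≠ 0 := by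
  have h : ∀ᵐ z ∂(P.map (N.offset k)), z ≠ 0 :=
    (hN.offset_uniform k).absolutelyContinuous.ae_le (Measure.ae_ne volume 0)
  exact ae_of_ae_map (hN.measurable_offset k).aemeasurable h

lemma ae_gain_pos (hN : N.IsModel P) (k l : ℕ) : ∀ᵐ ω ∂P, 0 < ‖N.gain k l ω‖ ^ 2 := by
  have hm : Measurable fun ω => ‖N.gain k l ω‖ ^ 2 := (hN.measurable_gain k l).norm.pow_const 2
  have h : ∀ᵐ z ∂(P.map fun ω => ‖N.gain k l ω‖ ^ 2), 0 < z := by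
    rw [hN.gain_law, ae_iff, ← lintegral_indicator_one (by measurability),
      lintegral_expMeasure_one (measurable_one.indicator (by measurability)),
      setLIntegral_congr_fun measurableSet_Ioi (g := fun _ => 0), lintegral_zero]
    intro x hx
    have hx : 0 < x := hx
    simp [hx]
  exact ae_of_ae_map hm.aemeasurable h

/-- Given everything but the signal fading, coverage is an exponential tail event at an independent
level. -/
lemma measure_covered_eq [IsProbabilityMeasure P] (hN : N.IsModel P) (m : Fin M) (k : ℕ) {β : ℝ}
    (hβ : 0 < β) :
    P (N.inGroup m k ∩ {ω | ENNReal.ofReal β ≤ N.sinr m k ω})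
      = ∫⁻ ω, (N.inGroup m k).indicator 1 ω * expNeg (ENNReal.ofReal (β * N.Z k ω) *
        (N.d2dInterference m k ω + N.cueInterference m k ω + ENNReal.ofReal (N.σ ^ 2))) ∂P := by
  have hA := measurable_inGroup_indicator (N := N) m k
  have hT := measurable_level (N := N) m k β
  have hle := hN.groupAlg_le {Source.gain k k}ᶜ
  have hH : Measurable fun ω => ‖N.gain k k ω‖ ^ 2 := (hN.measurable_gain k k).norm.pow_const 2
  have hind : IndepFun (fun ω => ((N.inGroup m k).indicator (1 : Ω → ℝ≥0∞) ω,
      ENNReal.ofReal (β * N.Z k ω) * (N.d2dInterference m k ω + N.cueInterference m k ω +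
        ENNReal.ofReal (N.σ ^ 2)))) (fun ω => ‖N.gain k k ω‖ ^ 2) P := by
    refine hN.indepFun (T := {Source.gain k k}) (hA.prodMk hT) ?_ disjoint_compl_left
    have := measurable_gain_groupAlg (N := N) (Set.mem_singleton (Source.gain k k))
    exact (by fun_prop : Measurable fun z : ℂ => ‖z‖ ^ 2).comp this
  have hA' := hA.mono hle le_rfl
  have hT' := hT.mono hle le_rfl
  rw [← lintegral_indicator_exponential hA' hT' hH hind (hN.gain_law k k)]
  have hG : MeasurableSet (N.inGroup m k) := by
    have : N.inGroup m k = (N.inGroup m k).indicator (1 : Ω → ℝ≥0∞) ⁻¹' {1} := by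
      ext ω; by_cases h : ω ∈ N.inGroup m k <;> simp [h]
    rw [this]
    exact hA' (measurableSet_singleton _)
  have hE := measurableSet_le hT' hH.ennreal_ofReal
  have hae : (N.inGroup m k ∩ {ω | ENNReal.ofReal β ≤ N.sinr m k ω} : Set Ω) =ᵐ[P]
      (N.inGroup m k ∩ {ω | ENNReal.ofReal (β * N.Z k ω) * (N.d2dInterference m k ω +
        N.cueInterference m k ω + ENNReal.ofReal (N.σ ^ 2)) ≤
        ENNReal.ofReal (‖N.gain k k ω‖ ^ 2)} : Set Ω) := by
    filter_upwards [ae_offset_ne_zero hN k, hN.power_pos k, ae_gain_pos hN k k] with ω h1 h2 h3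
    exact propext (and_congr_right fun _ => le_sinr_iff hβ h1 h2 h3)
  rw [measure_congr hae, ← lintegral_indicator_one (hG.inter hE)]
  refine lintegral_congr fun ω => ?_
  rw [Set.inter_indicator_one]
  rfl

end D2DNetwork

/-! ### The coverage probability of one link, given its mark and the positions -/

namespace D2DNetwork

variable {Ω : Type*} {M : ℕ} {N : D2DNetwork Ω M}

/-- The random variable `β * Z` as a function of the displacement and the power. -/
noncomputable def laplaceArg (N : D2DNetwork Ω M) (β : ℝ) (a : Plane × ℝ) : ℝ :=
  β * (‖a.1‖ ^ N.α / a.2)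

lemma laplaceArg_mark (β : ℝ) (k : ℕ) (ω : Ω) :
    N.laplaceArg β (N.offset k ω, N.power k ω) = β * N.Z k ω := by
  rw [laplaceArg, Z, linkDist_eq]

lemma measurable_laplaceArg (N : D2DNetwork Ω M) (β : ℝ) : Measurable (N.laplaceArg β) := by
  unfold laplaceArg
  fun_prop

lemma measurableSet_cell (N : D2DNetwork Ω M) : MeasurableSet N.cell :=
  Metric.isClosed_closedBall.measurableSet

lemma measurable_comp_cell_indicator (N : D2DNetwork Ω M) {X : Type*} {mX : MeasurableSpace X}
    {y : X → Plane} (hy : Measurable y) :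
    Measurable fun x => N.cell.indicator (1 : Plane → ℝ≥0∞) (y x) :=
  (measurable_one.indicator N.measurableSet_cell).comp hy

lemma measurable_positions_groupAlg {S : Set (Source M)} (h : Source.positions ∈ S) :
    Measurable[N.groupAlg S] fun ω i => N.tx i ω :=
  @measurable_pi_lambda _ _ _ (N.groupAlg S) _ _ fun i => measurable_tx_groupAlg h i

variable [MeasurableSpace Ω] {P : Measure Ω}

/-- The probability that the `k`-th link is in the group of the `m`-th cellular user, is in the cell
and is covered, given the displacement and the power `a` of this link and all the positions `t`. -/
noncomputable def linkKernel (N : D2DNetwork Ω M) (P : Measure Ω) (m : Fin M) (k₀ : ℕ) (β : ℝ)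
    (k : ℕ) (a : Plane × ℝ) (t : ℕ → Plane) : ℝ≥0∞ :=
  (P {ω | N.label k₀ ω = m} * N.cell.indicator 1 (t k + a.1) *
    expNeg (ENNReal.ofReal (N.laplaceArg β a) * ENNReal.ofReal (N.σ ^ 2)) *
    N.cueTransform P m (t k + a.1) (N.laplaceArg β a)) *
  expNeg (∑' i, if i = k then 0 else
    negLog (N.linkTransform P m k₀ (N.laplaceArg β a) (dist (t k + a.1) (t i))))

lemma measurable_comp_cueTransform [SFinite P] (hN : N.IsModel P) (m : Fin M) {X : Type*}
    [MeasurableSpace X] {y : X → Plane} {s : X → ℝ} (hy : Measurable y) (hs : Measurable s) :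
    Measurable fun x => N.cueTransform P m (y x) (s x) := by
  have h := (measurable_cueTransform hN m).comp (hy.prodMk hs)
  exact h

lemma measurable_comp_linkTransform [SFinite P] (hN : N.IsModel P) (m : Fin M) (k : ℕ)
    {X : Type*} [MeasurableSpace X] {s r : X → ℝ} (hs : Measurable s) (hr : Measurable r) :
    Measurable fun x => N.linkTransform P m k (s x) (r x) := by
  have h := (measurable_linkTransform hN m k).comp (hs.prodMk hr)
  exact h

lemma measurable_linkKernel [SFinite P] (hN : N.IsModel P) (m : Fin M) (k₀ : ℕ) (β : ℝ) (k : ℕ) :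
    Measurable fun z : (Plane × ℝ) × (ℕ → Plane) => N.linkKernel P m k₀ β k z.1 z.2 := by
  have hs : Measurable fun z : (Plane × ℝ) × (ℕ → Plane) => N.laplaceArg β z.1 :=
    (N.measurable_laplaceArg β).comp measurable_fst
  have hy : Measurable fun z : (Plane × ℝ) × (ℕ → Plane) => z.2 k + z.1.1 := by fun_prop
  have hI : Measurable fun z : (Plane × ℝ) × (ℕ → Plane) => ∑' i, if i = k then 0 else
      negLog (N.linkTransform P m k₀ (N.laplaceArg β z.1) (dist (z.2 k + z.1.1) (z.2 i))) := by
    refine Measurable.tsum fun i => ?_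
    split_ifs
    · exact measurable_const
    · exact measurable_negLog.comp (measurable_comp_linkTransform hN m k₀ hs
        (measurable_dist_comp hy (by fun_prop)))
  exact (((N.measurable_comp_cell_indicator hy).const_mul _).mul
    (hs.ennreal_ofReal.mul_const _).expNeg).mul (measurable_comp_cueTransform hN m hy hs) |>.mul
    hI.expNeg

/-- Passing from the mark of link `k` to an independent copy with the law of link `k₀` leaves `k`
only as the index of the selected Poisson point, so the sum over `k` can be taken for a fixed mark.
-/
lemma measure_covered_eq_lintegral_linkKernel [IsProbabilityMeasure P] (hN : N.IsModel P)
    (m : Fin M) (k₀ k : ℕ) {β : ℝ} (hβ : 0 < β) :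
    P (N.inGroup m k ∩ {ω | ENNReal.ofReal β ≤ N.sinr m k ω})
      = ∫⁻ ω, ∫⁻ ω', N.linkKernel P m k₀ β k (N.offset k₀ ω, N.power k₀ ω)
        (fun i => N.tx i ω') ∂P ∂P := by
  classical
  -- `U` collects the frozen sources (own mark and all positions), `V` the independent ones to be
  -- averaged; the own gain is already gone.
  let U : Ω → (Plane × ℝ) × (ℕ → Plane) :=
    fun ω => ((N.offset k ω, N.power k ω), fun i => N.tx i ω)
  let V : Ω → (Fin M × Plane × ℝ × ℂ) × ({i : ℕ // i ≠ k} → Fin M × ℝ × ℂ) :=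
    fun ω => ((N.label k ω, N.cue m ω, N.cuePower ω, N.cueGain k m ω),
      fun i => (N.label i ω, N.power i ω, N.gain k i ω))
  let G : (Plane × ℝ) × (ℕ → Plane) →
      (Fin M × Plane × ℝ × ℂ) × ({i : ℕ // i ≠ k} → Fin M × ℝ × ℂ) → ℝ≥0∞ :=
    fun u v => (({m} : Set (Fin M)).indicator 1 v.1.1 * N.cell.indicator 1 (u.2 k + u.1.1)) *
      expNeg (ENNReal.ofReal (N.laplaceArg β u.1) *
        ((∑' i : {i : ℕ // i ≠ k}, if (v.2 i).1 = m then
          N.rxPower (v.2 i).2.1 (v.2 i).2.2 (dist (u.2 k + u.1.1) (u.2 i)) else 0) +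
        N.rxPower v.1.2.2.1 v.1.2.2.2 (dist (u.2 k + u.1.1) v.1.2.1) + ENNReal.ofReal (N.σ ^ 2)))
  have hU : Measurable[N.groupAlg {Source.mark k, Source.positions}] U :=
    (measurable_mark_groupAlg (by simp)).prodMk
      (measurable_positions_groupAlg (by simp))
  have hV : Measurable[N.groupAlg {Source.mark k, Source.positions}ᶜ] V := by
    refine Measurable.prodMk (Measurable.prodMk (measurable_label_groupAlg (by simp))
      ((measurable_cue_groupAlg (by simp)).prodMk ((measurable_cuePower_groupAlg (by simp)).prodMk
        (measurable_cueGain_groupAlg (by simp)))))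
      (@measurable_pi_lambda _ _ _ (N.groupAlg _) _ _ fun i => ?_)
    exact (measurable_label_groupAlg (by simp)).prodMk
      ((measurable_power_groupAlg (by simp [i.2])).prodMk (measurable_gain_groupAlg (by simp)))
  have hU' : Measurable U := hU.mono (hN.groupAlg_le _) le_rfl
  have hV' : Measurable V := hV.mono (hN.groupAlg_le _) le_rfl
  have hG : Measurable (Function.uncurry G) := by
    have hs : Measurable fun z : ((Plane × ℝ) × (ℕ → Plane)) ×
        ((Fin M × Plane × ℝ × ℂ) × ({i : ℕ // i ≠ k} → Fin M × ℝ × ℂ)) =>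
        N.laplaceArg β z.1.1 := (N.measurable_laplaceArg β).comp (by fun_prop)
    have hy : Measurable fun z : ((Plane × ℝ) × (ℕ → Plane)) ×
        ((Fin M × Plane × ℝ × ℂ) × ({i : ℕ // i ≠ k} → Fin M × ℝ × ℂ)) =>
        z.1.2 k + z.1.1.1 := by fun_prop
    refine Measurable.mul (Measurable.mul ?_ ?_) (hs.ennreal_ofReal.mul ((Measurable.add ?_ ?_).add
      measurable_const)).expNeg
    · exact (measurable_one.indicator (measurableSet_singleton m)).comp (by fun_prop)
    · exact N.measurable_comp_cell_indicator hy
    · exact N.measurable_tsum_rxPower m (by fun_prop) (by fun_prop) (by fun_prop)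
        (fun i => measurable_dist_comp hy (by fun_prop))
    · exact N.measurable_rxPower (by fun_prop) (by fun_prop) (measurable_dist_comp hy (by fun_prop))
  have h1 : P (N.inGroup m k ∩ {ω | ENNReal.ofReal β ≤ N.sinr m k ω})
      = ∫⁻ ω, G (U ω) (V ω) ∂P := by
    rw [measure_covered_eq hN m k hβ]
    refine lintegral_congr fun ω => ?_
    simp only [G, U, V, laplaceArg_mark, d2dInterference_eq]
    congr 1
    by_cases h : N.label k ω = m <;> by_cases h' : N.tx k ω + N.offset k ω ∈ N.cell <;>
      simp [inGroup, rx, h, h']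
  have h2 : ∀ u, ∫⁻ ω, G u (V ω) ∂P = N.linkKernel P m k₀ β k u.1 u.2 := by
    intro u
    set s := N.laplaceArg β u.1
    set y := u.2 k + u.1.1
    have e1 : ∀ ω, G u (V ω) = (N.cell.indicator 1 y * expNeg (ENNReal.ofReal s *
        ENNReal.ofReal (N.σ ^ 2))) * ({ω | N.label k ω = m}.indicator 1 ω *
        (expNeg (ENNReal.ofReal s *
          N.rxPower (N.cuePower ω) (N.cueGain k m ω) (dist y (N.cue m ω))) *
        expNeg (ENNReal.ofReal s * ∑' i : {i : ℕ // i ≠ k}, if N.label i ω = m then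
          N.rxPower (N.power i ω) (N.gain k i ω) (dist y (u.2 i)) else 0))) := by
      intro ω
      simp only [G, V]
      rw [mul_add, mul_add, expNeg_add, expNeg_add]
      by_cases h : N.label k ω = m
      · simp only [h, Set.indicator_of_mem (Set.mem_singleton m),
          Set.indicator_of_mem (show ω ∈ {ω | N.label k ω = m} from h), Pi.one_apply]
        ring
      · simp [h]
    have hCm : Measurable[N.groupAlg {Source.cuePower, Source.cue m, Source.cueGain k m}] fun ω =>
        expNeg (ENNReal.ofReal s *
          N.rxPower (N.cuePower ω) (N.cueGain k m ω) (dist y (N.cue m ω))) :=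
      (by fun_prop : Measurable fun x => expNeg (ENNReal.ofReal s * x)).comp
        (N.measurable_rxPower (measurable_cuePower_groupAlg (by simp))
          (measurable_cueGain_groupAlg (by simp))
          (measurable_dist_comp measurable_const (measurable_cue_groupAlg (by simp))))
    have hIm : Measurable[N.groupAlg {x | ∃ i, i ≠ k ∧ (x = Source.label i ∨ x = Source.mark i ∨
        x = Source.gain k i)}] fun ω =>
        expNeg (ENNReal.ofReal s * ∑' i : {i : ℕ // i ≠ k}, if N.label i ω = m then
          N.rxPower (N.power i ω) (N.gain k i ω) (dist y (u.2 i)) else 0) :=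
      (by fun_prop : Measurable fun x => expNeg (ENNReal.ofReal s * x)).comp
        (N.measurable_tsum_rxPower m
          (fun i => measurable_label_groupAlg ⟨i, i.2, Or.inl rfl⟩)
          (fun i => measurable_power_groupAlg ⟨i, i.2, Or.inr (Or.inl rfl)⟩)
          (fun i => measurable_gain_groupAlg ⟨i, i.2, Or.inr (Or.inr rfl)⟩)
          (fun i => measurable_const))
    have hlm : Measurable[N.groupAlg {Source.label k}]
        ({ω | N.label k ω = m}.indicator (1 : Ω → ℝ≥0∞)) :=
      Measurable.indicator measurable_const
        (measurable_label_groupAlg (N := N) (Set.mem_singleton (Source.label k))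
          (measurableSet_singleton m))
    have hCIm : Measurable[N.groupAlg {Source.label k}ᶜ] fun ω =>
        expNeg (ENNReal.ofReal s *
          N.rxPower (N.cuePower ω) (N.cueGain k m ω) (dist y (N.cue m ω))) *
        expNeg (ENNReal.ofReal s * ∑' i : {i : ℕ // i ≠ k}, if N.label i ω = m then
          N.rxPower (N.power i ω) (N.gain k i ω) (dist y (u.2 i)) else 0) := by
      refine measurable_mul.comp (Measurable.prodMk (hCm.mono ?_ le_rfl) (hIm.mono ?_ le_rfl))
      · refine iSup₂_le fun x hx => N.sigmaAlg_le_groupAlg ?_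
        rcases hx with rfl | rfl | rfl <;> simp
      · refine iSup₂_le fun x hx => N.sigmaAlg_le_groupAlg ?_
        obtain ⟨i, hi, rfl | rfl | rfl⟩ := hx <;> simp [hi]
    have hd : Disjoint ({Source.cuePower, Source.cue m, Source.cueGain k m} : Set (Source M))
        {x | ∃ i, i ≠ k ∧ (x = Source.label i ∨ x = Source.mark i ∨ x = Source.gain k i)} := by
      rw [Set.disjoint_left]
      rintro x (rfl | rfl | rfl) ⟨i, hi, h | h | h⟩ <;> simp at h
    simp_rw [e1]
    have hm := (hlm.mono (hN.groupAlg_le _) le_rfl).mul (hCIm.mono (hN.groupAlg_le _) le_rfl)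
    refine (lintegral_const_mul _ hm).trans ?_
    simp only [Pi.mul_apply]
    rw [hN.lintegral_mul hlm hCIm disjoint_compl_right, hN.lintegral_mul hCm hIm hd,
      lintegral_expNeg_cue hN, lintegral_expNeg_interference hN m k₀,
      lintegral_indicator_one (measurable_label_eq hN k m), hN.label_ident k k₀ m, linkKernel]
    ring
  rw [h1, lintegral_comp_of_indepFun hU' hV' (hN.indepFun hU hV disjoint_compl_right) hG]
  simp_rw [h2]
  have hK := measurable_linkKernel hN m k₀ β k
  -- The own mark is independent of the positions, so it is averaged separately and then exchanged
  -- for the mark of `k₀`.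
  rw [lintegral_comp_of_indepFun (G := fun a t => N.linkKernel P m k₀ β k a t)
    (hU'.fst) (hU'.snd) ?_ hK]
  · exact lintegral_comp_mark_eq hN k k₀ (u := fun a => ∫⁻ ω', N.linkKernel P m k₀ β k a
      (fun i => N.tx i ω') ∂P)
      ((hK.comp (measurable_fst.prodMk (hU'.snd.comp measurable_snd))).lintegral_prod_right'
        (f := fun z : (Plane × ℝ) × Ω => N.linkKernel P m k₀ β k z.1 (fun i => N.tx i z.2)))
  · refine hN.indepFun (S := {Source.mark k}) (T := {Source.positions})
      (measurable_mark_groupAlg (by simp))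
      (measurable_positions_groupAlg (by simp)) (by simp)

end D2DNetwork

/-! ### Summation over the Poisson points -/

namespace D2DNetwork

variable {Ω : Type*} {M : ℕ} {N : D2DNetwork Ω M}

lemma volume_cell_ne_top (N : D2DNetwork Ω M) : volume N.cell ≠ ∞ :=
  (isCompact_closedBall 0 N.RC).measure_lt_top.ne

/-- Translation invariance removes the displacement: under Lebesgue measure for the transmitter, the
receiver is again spread uniformly over the cell. -/
lemma lintegral_cell_indicator_translate (N : D2DNetwork Ω M) (f : Plane → ℝ≥0∞) (o : Plane) :
    ∫⁻ x, N.cell.indicator 1 (x + o) * f (x + o) = ∫⁻ y in N.cell, f y := by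
  rw [lintegral_add_right_eq_self (fun x => N.cell.indicator 1 x * f x) o,
    ← lintegral_indicator N.measurableSet_cell]
  refine lintegral_congr fun x => ?_
  by_cases h : x ∈ N.cell <;> simp [h]

variable [MeasurableSpace Ω] {P : Measure Ω}

/-! ### The interference functional as a function of the distance -/

lemma sigmaFinite_intensity (c : ℝ) : SigmaFinite (ENNReal.ofReal c • (volume : Measure Plane)) :=
  inferInstanceAs (SigmaFinite (Real.toNNReal c • (volume : Measure Plane)))

lemma continuous_loss {α : ℝ} {c : ℝ≥0∞} (hc : c ≠ ∞) :
    Continuous fun r : ℝ => 1 - (1 + c * ENNReal.ofReal r ^ (-α))⁻¹ :=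
  (ENNReal.continuous_sub_left ENNReal.one_ne_top).comp (continuous_inv.comp
    (continuous_const.add ((ENNReal.continuous_const_mul hc).comp
      (ENNReal.continuous_rpow_const.comp ENNReal.continuous_ofReal))))

lemma antitone_loss {α : ℝ} (hα : 0 ≤ α) (c : ℝ≥0∞) :
    Antitone fun r : ℝ => 1 - (1 + c * ENNReal.ofReal r ^ (-α))⁻¹ := by
  intro r r' h
  have h1 : ENNReal.ofReal r' ^ (-α) ≤ ENNReal.ofReal r ^ (-α) := by
    rw [ENNReal.rpow_neg, ENNReal.rpow_neg, ENNReal.inv_le_inv]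
    exact ENNReal.rpow_le_rpow (ENNReal.ofReal_le_ofReal h) hα
  exact tsub_le_tsub_left (ENNReal.inv_le_inv.2 (by gcongr)) _

lemma continuous_fadingLoss [IsProbabilityMeasure P] (hN : N.IsModel P) (k : ℕ) (s : ℝ) :
    Continuous (N.fadingLoss P k s) := by
  have hp := hN.measurable_power k
  refine continuous_iff_continuousAt.2 fun r => ?_
  refine tendsto_lintegral_filter_of_dominated_convergence (fun _ => 1)
    (Filter.Eventually.of_forall fun r => by fun_prop)
    (Filter.Eventually.of_forall fun r => ae_of_all _ fun ω => tsub_le_self) (by simp)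
    (ae_of_all _ fun ω => ?_)
  exact (continuous_loss (ENNReal.mul_ne_top ENNReal.ofReal_ne_top ENNReal.ofReal_ne_top)).tendsto r

lemma antitone_fadingLoss (hN : N.IsModel P) (k : ℕ) (s : ℝ) : Antitone (N.fadingLoss P k s) :=
  fun _ _ h => lintegral_mono fun _ =>
    antitone_loss (by linarith [hN.two_lt_α]) _ h

/-- At positive distance the averaged inverse is everywhere positive. This keeps the exponent in the
Mecke formula finite even when every link has label `m`. -/
lemma fadingLoss_lt_one [IsProbabilityMeasure P] (hN : N.IsModel P) (k : ℕ) (s : ℝ) {r : ℝ}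
    (hr : 0 < r) : N.fadingLoss P k s r < 1 := by
  have hp := hN.measurable_power k
  have hm : Measurable fun ω => (1 + ENNReal.ofReal s * ENNReal.ofReal (N.power k ω) *
      ENNReal.ofReal r ^ (-N.α))⁻¹ := by fun_prop
  have hle : ∀ ω, (1 + ENNReal.ofReal s * ENNReal.ofReal (N.power k ω) *
      ENNReal.ofReal r ^ (-N.α))⁻¹ ≤ 1 := fun ω => ENNReal.inv_le_one.2 le_self_add
  have h0 : ∫⁻ ω, (1 + ENNReal.ofReal s * ENNReal.ofReal (N.power k ω) *
      ENNReal.ofReal r ^ (-N.α))⁻¹ ∂P ≠ 0 := by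
    rw [Ne, lintegral_eq_zero_iff hm]
    intro h
    have : ∀ᵐ ω ∂P, False := by
      filter_upwards [h] with ω hω
      have h2 : (1 + ENNReal.ofReal s * ENNReal.ofReal (N.power k ω) *
        ENNReal.ofReal r ^ (-N.α)) = ∞ := ENNReal.inv_eq_zero.1 hω
      rw [ENNReal.ofReal_rpow_of_pos hr] at h2
      exact ENNReal.add_ne_top.2 ⟨ENNReal.one_ne_top, ENNReal.mul_ne_top
        (ENNReal.mul_ne_top ENNReal.ofReal_ne_top ENNReal.ofReal_ne_top) ENNReal.ofReal_ne_top⟩ h2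
    exact IsProbabilityMeasure.ne_zero P (by simpa using this)
  rw [fadingLoss, lintegral_one_sub_eq _ hm hle]
  exact ENNReal.sub_lt_self ENNReal.one_ne_top one_ne_zero h0

lemma continuous_linkTransform [IsProbabilityMeasure P] (hN : N.IsModel P) (m : Fin M) (k : ℕ)
    (s : ℝ) : Continuous (N.linkTransform P m k s) :=
  (ENNReal.continuous_sub_left ENNReal.one_ne_top).comp
    ((ENNReal.continuous_const_mul (measure_ne_top P _)).comp (continuous_fadingLoss hN k s))

lemma monotone_linkTransform (hN : N.IsModel P) (m : Fin M) (k : ℕ) (s : ℝ) :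
    Monotone (N.linkTransform P m k s) := fun _ _ h =>
  tsub_le_tsub_left (mul_le_mul_right (antitone_fadingLoss hN k s h) _) _

lemma negLog_linkTransform_ne_top [IsProbabilityMeasure P] (hN : N.IsModel P) (m : Fin M) (k : ℕ)
    (s : ℝ) {r : ℝ} (hr : 0 < r) : negLog (N.linkTransform P m k s r) ≠ ∞ := by
  refine negLog_ne_top (linkTransform_le_one _ _ _ _) ?_
  rw [linkTransform, Ne, tsub_eq_zero_iff_le, not_le]
  exact (mul_le_of_le_one_left' prob_le_one).trans_lt (fadingLoss_lt_one hN k s hr)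

lemma lintegral_fadingLoss [SFinite P] (hN : N.IsModel P) (k : ℕ) {s : ℝ} (hs : 0 ≤ s) :
    ∫⁻ z : Plane, N.fadingLoss P k s ‖z‖
      = ∫⁻ ω, ENNReal.ofReal ((s * N.power k ω) ^ (2 / N.α) *
        (Real.pi / Real.sinc (Real.pi * (2 / N.α)))) ∂P := by
  have hp := hN.measurable_power k
  simp_rw [fadingLoss]
  rw [lintegral_lintegral_swap (by fun_prop)]
  refine lintegral_congr_ae ?_
  filter_upwards [hN.power_pos k] with ω hω
  rw [← lintegral_one_sub_inv_one_add_mul_rpow hN.two_lt_α (mul_nonneg hs hω.le)]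
  simp_rw [ENNReal.ofReal_mul hs]

/-- The exponent of the Laplace functional of the interference. -/
lemma lintegral_expNeg_negLog_linkTransform [IsProbabilityMeasure P] (hN : N.IsModel P)
    (m : Fin M) (k : ℕ) (s : ℝ) (y : Plane) :
    ∫⁻ ω, expNeg (∑' i, negLog (N.linkTransform P m k s (dist y (N.tx i ω)))) ∂P
      = expNeg (ENNReal.ofReal N.lam * (P {ω | N.label k ω = m} *
        ∫⁻ z : Plane, N.fadingLoss P k s ‖z‖)) := by
  have := sigmaFinite_intensity N.lam
  have hf : Measurable fun z : Plane => negLog (N.linkTransform P m k s (dist y z)) :=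
    measurable_negLog.comp ((continuous_linkTransform hN m k s).measurable.comp
      (measurable_const.dist measurable_id))
  have h1 := hN.poisson.lintegral_expNeg_tsum hf
  have h2 : ∀ z, 1 - expNeg (negLog (N.linkTransform P m k s (dist y z)))
      = P {ω | N.label k ω = m} * N.fadingLoss P k s ‖y - z‖ := by
    intro z
    rw [expNeg_negLog (linkTransform_le_one _ _ _ _), linkTransform,
      ENNReal.sub_sub_cancel ENNReal.one_ne_top, dist_eq_norm]
    exact mul_le_one' prob_le_one (fadingLoss_le_one _ _ _)
  have hL : Measurable fun z : Plane => N.fadingLoss P k s ‖z‖ :=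
    (continuous_fadingLoss hN k s).measurable.comp measurable_norm
  simp_rw [h2] at h1
  -- The substitution `z ↦ y - z` preserves Lebesgue measure, so the receiver position `y` drops
  -- out.
  rw [h1, lintegral_smul_measure, smul_eq_mul,
    lintegral_sub_left_eq_self (fun z => P {ω | N.label k ω = m} * N.fadingLoss P k s ‖z‖) y,
    lintegral_const_mul _ hL]

/-! ### Summing over all links -/

lemma volume_cell_ne_zero (hN : N.IsModel P) : volume N.cell ≠ 0 :=
  (Metric.measure_closedBall_pos volume 0 hN.RC_pos).ne'

lemma cueTransform_le_one [IsProbabilityMeasure P] (m : Fin M) (y : Plane) (s : ℝ) :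
    N.cueTransform P m y s ≤ 1 :=
  (lintegral_mono fun _ => ENNReal.inv_le_one.2 le_self_add).trans (by simp)

/-- The Mecke formula for a fixed mark `a`: the Laplace functional does not depend on the added
point and leaves the integral, so only the cellular factor is averaged over the cell. -/
lemma tsum_lintegral_linkKernel [IsProbabilityMeasure P] (hN : N.IsModel P) (m : Fin M)
    (k₀ : ℕ) (β : ℝ) (a : Plane × ℝ) :
    ∑' k, ∫⁻ ω, N.linkKernel P m k₀ β k a (fun i => N.tx i ω) ∂P
      = ENNReal.ofReal N.lam * P {ω | N.label k₀ ω = m} *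
        (expNeg (ENNReal.ofReal (N.laplaceArg β a) * ENNReal.ofReal (N.σ ^ 2)) *
          expNeg (ENNReal.ofReal N.lam * (P {ω | N.label k₀ ω = m} *
            ∫⁻ z : Plane, N.fadingLoss P k₀ (N.laplaceArg β a) ‖z‖)) *
          ∫⁻ y in N.cell, N.cueTransform P m y (N.laplaceArg β a)) := by
  have := sigmaFinite_intensity N.lam
  set s := N.laplaceArg β a
  set q := P {ω | N.label k₀ ω = m}
  set e := expNeg (ENNReal.ofReal s * ENNReal.ofReal (N.σ ^ 2))
  have hC : Measurable fun y : Plane => N.cueTransform P m y s :=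
    measurable_comp_cueTransform hN m measurable_id measurable_const
  let F : Plane → ℝ≥0∞ := fun x => q * N.cell.indicator 1 (x + a.1) * e *
    N.cueTransform P m (x + a.1) s
  have hFm : Measurable F :=
    (((N.measurable_comp_cell_indicator (by fun_prop)).const_mul _).mul_const _).mul
      (measurable_comp_cueTransform hN m (by fun_prop) measurable_const)
  have hF : ∫⁻ x, F x ∂(ENNReal.ofReal N.lam • (volume : Measure Plane))
      = ENNReal.ofReal N.lam * (q * e * ∫⁻ y in N.cell, N.cueTransform P m y s) := by
    have hm : Measurable fun x : Plane => N.cell.indicator (1 : Plane → ℝ≥0∞) (x + a.1) *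
        N.cueTransform P m (x + a.1) s :=
      (N.measurable_comp_cell_indicator (by fun_prop)).mul
        (measurable_comp_cueTransform hN m (by fun_prop) measurable_const)
    rw [lintegral_smul_measure, smul_eq_mul,
      ← N.lintegral_cell_indicator_translate (fun y => N.cueTransform P m y s) a.1,
      ← lintegral_const_mul (q * e) hm]
    congr 1
    exact lintegral_congr fun x => by simp only [F]; ring
  have hcell : ∫⁻ y in N.cell, N.cueTransform P m y s ≠ ∞ := by
    refine ne_top_of_le_ne_top N.volume_cell_ne_top
      ((lintegral_mono fun y => cueTransform_le_one m y s).trans ?_)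
    simp
  have hFtop : ∫⁻ x, F x ∂(ENNReal.ofReal N.lam • (volume : Measure Plane)) ≠ ∞ := by
    rw [hF]
    exact ENNReal.mul_ne_top ENNReal.ofReal_ne_top (ENNReal.mul_ne_top
      (ENNReal.mul_ne_top (measure_ne_top P _) (expNeg_ne_top _)) hcell)
  have hmecke := hN.poisson.mecke_dist hN.measurable_tx
    (u := fun r => negLog (N.linkTransform P m k₀ s r))
    (continuous_negLog.comp (continuous_linkTransform hN m k₀ s))
    (fun _ _ h => antitone_negLog (monotone_linkTransform hN m k₀ s h))
    (fun r hr => negLog_linkTransform_ne_top hN m k₀ s hr) a.1 hFm hFtop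
  simp_rw [lintegral_expNeg_negLog_linkTransform hN] at hmecke
  rw [lintegral_mul_const _ hFm, hF] at hmecke
  refine Eq.trans ?_ (hmecke.trans (by ring))
  rfl

lemma measurable_lintegral_cell_indicator [SFinite P] (hN : N.IsModel P) (k : ℕ) :
    Measurable fun o : Plane =>
      ∫⁻ ω, N.cell.indicator (1 : Plane → ℝ≥0∞) (N.tx k ω + o) ∂P := by
  have hy : Measurable fun z : Plane × Ω => N.tx k z.2 + z.1 :=
    ((hN.measurable_tx k).comp measurable_snd).add measurable_fst
  have h : Measurable fun z : Plane × Ω => N.cell.indicator (1 : Plane → ℝ≥0∞)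
    (N.tx k z.2 + z.1) := N.measurable_comp_cell_indicator hy
  exact h.lintegral_prod_right'

/-- With the displacement of `k₀` in place of that of `k`, Campbell's formula can be applied to the
sum over `k` with a common displacement. -/
lemma measure_inGroup_eq [IsProbabilityMeasure P] (hN : N.IsModel P) (m : Fin M) (k₀ k : ℕ) :
    P (N.inGroup m k) = P {ω | N.label k₀ ω = m} *
      ∫⁻ ω, ∫⁻ ω', N.cell.indicator 1 (N.tx k ω' + N.offset k₀ ω) ∂P ∂P := by
  have hl : Measurable[N.groupAlg {Source.label k}]
      ({ω | N.label k ω = m}.indicator (1 : Ω → ℝ≥0∞)) :=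
    Measurable.indicator measurable_const
      (measurable_label_groupAlg (N := N) (Set.mem_singleton (Source.label k))
        (measurableSet_singleton m))
  have hc : Measurable[N.groupAlg {Source.positions, Source.mark k}]
      fun ω => N.cell.indicator (1 : Plane → ℝ≥0∞) (N.rx k ω) :=
    N.measurable_comp_cell_indicator (measurable_rx_groupAlg (by simp) (by simp))
  have hG : MeasurableSet (N.inGroup m k) :=
    (measurable_label_eq hN k m).inter (((hN.measurable_tx k).add (hN.measurable_offset k))
      N.measurableSet_cell)
  have h2 : P (N.inGroup m k) = ∫⁻ ω, {ω | N.label k ω = m}.indicator 1 ω *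
      N.cell.indicator 1 (N.rx k ω) ∂P := by
    rw [← lintegral_indicator_one hG]
    refine lintegral_congr fun ω => ?_
    by_cases h : N.label k ω = m <;> by_cases h' : N.rx k ω ∈ N.cell <;>
      simp [inGroup, h, h']
  have hcm : Measurable fun z : Plane × Plane =>
      N.cell.indicator (1 : Plane → ℝ≥0∞) (z.2 + z.1) :=
    N.measurable_comp_cell_indicator (by fun_prop)
  have hind : IndepFun (N.offset k) (N.tx k) P :=
    hN.indepFun (S := {Source.mark k}) (T := {Source.positions})
      (measurable_offset_groupAlg (by simp)) (measurable_tx_groupAlg (by simp) k) (by simp)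
  have h3 := lintegral_comp_of_indepFun
    (G := fun o x => N.cell.indicator (1 : Plane → ℝ≥0∞) (x + o))
    (hN.measurable_offset k) (hN.measurable_tx k) hind hcm
  have hu : Measurable fun a : Plane × ℝ =>
      ∫⁻ ω', N.cell.indicator (1 : Plane → ℝ≥0∞) (N.tx k ω' + a.1) ∂P := by
    have hf : Measurable fun a : Plane × ℝ => a.1 := measurable_fst
    have h := (measurable_lintegral_cell_indicator hN k).comp hf
    exact h
  have h4 := lintegral_comp_mark_eq hN k k₀ hu
  rw [h2, hN.lintegral_mul hl hc (by simp), lintegral_indicator_one (measurable_label_eq hN k m),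
    hN.label_ident k k₀ m]
  congr 1
  exact h3.trans h4

/-- The mean number of links of the cell that share the resource of the `m`-th cellular user. -/
lemma meanLinks_eq [IsProbabilityMeasure P] (hN : N.IsModel P) (m : Fin M) (k₀ : ℕ) :
    N.meanLinks P m = ENNReal.ofReal N.lam * P {ω | N.label k₀ ω = m} * volume N.cell := by
  have := sigmaFinite_intensity N.lam
  have hu : ∀ k, Measurable fun ω =>
      ∫⁻ ω', N.cell.indicator (1 : Plane → ℝ≥0∞) (N.tx k ω' + N.offset k₀ ω) ∂P := fun k => by
    have h := (measurable_lintegral_cell_indicator hN k).comp (hN.measurable_offset k₀)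
    exact h
  have h4 : ∀ o : Plane, ∑' k, ∫⁻ ω', N.cell.indicator (1 : Plane → ℝ≥0∞) (N.tx k ω' + o) ∂P
      = ENNReal.ofReal N.lam * volume N.cell := by
    intro o
    have h5 := hN.poisson.tsum_lintegral hN.measurable_tx
      (F := fun x => N.cell.indicator (1 : Plane → ℝ≥0∞) (x + o))
      (N.measurable_comp_cell_indicator (by fun_prop))
    have h6 := N.lintegral_cell_indicator_translate 1 o
    simp only [Pi.one_apply, mul_one, lintegral_one, Measure.restrict_apply_univ] at h6
    rw [h5, lintegral_smul_measure, smul_eq_mul, h6]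
  simp_rw [meanLinks, measure_inGroup_eq hN m k₀]
  rw [ENNReal.tsum_mul_left, ← lintegral_tsum fun k => (hu k).aemeasurable]
  simp_rw [h4]
  simp only [lintegral_const, measure_univ, mul_one]
  ring

end D2DNetwork

/-! ### From integrals in `[0, ∞]` to the real formula -/

namespace D2DNetwork

variable {Ω : Type*} {M : ℕ} {N : D2DNetwork Ω M}

lemma linkDist_nonneg (k : ℕ) (ω : Ω) : 0 ≤ N.linkDist k ω := dist_nonneg

variable [MeasurableSpace Ω] {P : Measure Ω}

lemma measurable_linkDist (hN : N.IsModel P) (k : ℕ) : Measurable (N.linkDist k) := by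
  have h := (hN.measurable_offset k).norm
  rwa [← funext (linkDist_eq (N := N) k)] at h

lemma measurable_Z (hN : N.IsModel P) (k : ℕ) : Measurable (N.Z k) :=
  ((measurable_linkDist hN k).pow_const _).div (hN.measurable_power k)

lemma ae_Z_nonneg (hN : N.IsModel P) (k : ℕ) : ∀ᵐ ω ∂P, 0 ≤ N.Z k ω := by
  filter_upwards [hN.power_pos k] with ω hω
  exact div_nonneg (Real.rpow_nonneg (linkDist_nonneg k ω) _) hω.le

lemma meanLinks_ne_zero [IsProbabilityMeasure P] (hN : N.IsModel P) (m : Fin M)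
    (hq : ∀ k, P {ω | N.label k ω = m} ≠ 0) : N.meanLinks P m ≠ 0 := by
  rw [meanLinks_eq hN m 0]
  exact mul_ne_zero (mul_ne_zero (ENNReal.ofReal_pos.2 hN.lam_pos).ne' (hq 0))
    (volume_cell_ne_zero hN)

lemma meanLinks_ne_top [IsProbabilityMeasure P] (hN : N.IsModel P) (m : Fin M) :
    N.meanLinks P m ≠ ∞ := by
  rw [meanLinks_eq hN m 0]
  exact ENNReal.mul_ne_top (ENNReal.mul_ne_top ENNReal.ofReal_ne_top (measure_ne_top P _))
    N.volume_cell_ne_top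

/-! ### The Laplace transform of the interference from the cellular user -/

/-- At distance `0` the path loss `d^(-α)` is `∞` in `ℝ≥0∞` but `0` for real powers. The two
definitions of the cellular interference agree off this null event. -/
lemma ae_dist_cue_pos (hN : N.IsModel P) (m : Fin M) (u : Plane) :
    ∀ᵐ ω ∂P, 0 < dist u (N.cue m ω) := by
  have hac := (hN.cue_uniform m).absolutelyContinuous
  have h0 : P.map (N.cue m) {u} = 0 := hac (measure_singleton u)
  rw [Measure.map_apply (hN.measurable_cue m) (measurableSet_singleton u)] at h0
  filter_upwards [measure_eq_zero_iff_ae_notMem.1 h0] with ω hω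
  exact dist_pos.2 fun h => hω h.symm

lemma integral_exp_neg_Y [IsProbabilityMeasure P] (hN : N.IsModel P) (m : Fin M) (k : ℕ)
    (u : Plane) {s : ℝ} (hs : 0 ≤ s) :
    ∫ ω, Real.exp (-(s * N.Y m k u ω)) ∂P = (N.cueTransform P m u s).toReal := by
  have hd : Measurable fun ω => dist u (N.cue m ω) :=
    measurable_dist_comp measurable_const (hN.measurable_cue m)
  have hY : Measurable (N.Y m k u) :=
    (((hN.measurable_cueGain k m).norm.pow_const _).mul (hd.pow_const _)).mul
      hN.measurable_cuePower
  rw [integral_eq_lintegral_of_nonneg_ae (ae_of_all _ fun ω => (Real.exp_pos _).le)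
    (by fun_prop), ← lintegral_expNeg_cue hN m k]
  congr 1
  refine lintegral_congr_ae ?_
  filter_upwards [hN.cuePower_nonneg, ae_dist_cue_pos hN m u] with ω h1 h2
  rw [rxPower, ENNReal.ofReal_rpow_of_pos h2, ← ENNReal.ofReal_mul h1,
    ← ENNReal.ofReal_mul (by positivity), ← ENNReal.ofReal_mul hs, expNeg_ofReal (by positivity), Y]
  congr 3
  ring

lemma laplaceY_eq [IsProbabilityMeasure P] (hN : N.IsModel P) (m : Fin M) (k : ℕ) {s : ℝ}
    (hs : 0 ≤ s) : N.laplaceY P m k s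
      = ((volume N.cell)⁻¹ * ∫⁻ y in N.cell, N.cueTransform P m y s).toReal := by
  have hC : Measurable fun y : Plane => N.cueTransform P m y s :=
    measurable_comp_cueTransform hN m measurable_id measurable_const
  simp_rw [laplaceY, integral_exp_neg_Y hN m k _ hs]
  rw [integral_toReal hC.aemeasurable
    (ae_of_all _ fun y => (cueTransform_le_one m y s).trans_lt ENNReal.one_lt_top),
    ProbabilityTheory.cond, lintegral_smul_measure, smul_eq_mul]

lemma lintegral_cueTransform_ne_top [IsProbabilityMeasure P] (m : Fin M) (s : ℝ) :
    ∫⁻ y in N.cell, N.cueTransform P m y s ≠ ∞ := by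
  refine ne_top_of_le_ne_top N.volume_cell_ne_top
    ((lintegral_mono fun y => cueTransform_le_one m y s).trans ?_)
  simp

/-! ### The Laplace transform of the interference from the other links -/

lemma two_div_α_pos (hN : N.IsModel P) : 0 < 2 / N.α :=
  div_pos two_pos (two_pos.trans hN.two_lt_α)

lemma two_div_α_lt_one (hN : N.IsModel P) : 2 / N.α < 1 :=
  (div_lt_one (two_pos.trans hN.two_lt_α)).2 hN.two_lt_α

lemma pi_div_sinc_pos (hN : N.IsModel P) : 0 < Real.pi / Real.sinc (Real.pi * (2 / N.α)) := by
  have h0 := two_div_α_pos hN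
  have h1 := two_div_α_lt_one hN
  rw [← pi_div_sinc h0]
  exact mul_pos (mul_pos Real.pi_pos (Real.Gamma_pos_of_pos (by linarith)))
    (Real.Gamma_pos_of_pos (by linarith))

lemma theta_nonneg (hN : N.IsModel P) (m : Fin M) (k : ℕ) {β : ℝ} (hβ : 0 ≤ β) :
    0 ≤ N.theta P m k β := by
  have hC := pi_div_sinc_pos hN
  have hI : 0 ≤ ∫ ω, N.power k ω ^ (2 / N.α) ∂P := integral_nonneg_of_ae <| by
    filter_upwards [hN.power_pos k] with ω hω
    exact Real.rpow_nonneg hω.le _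
  have hl := hN.lam_pos
  have : N.theta P m k β = Real.pi / Real.sinc (Real.pi * (2 / N.α)) *
      (P.real {ω | N.label k ω = m} * N.lam * β ^ (2 / N.α) *
        ∫ ω, N.power k ω ^ (2 / N.α) ∂P) := by
    rw [theta]; ring
  rw [this]
  positivity

/-- The radial integral with constant `βzp` scales as `(βzp)^(2/α)`, and averaging over `p` leaves
the fractional moment in `theta`. -/
lemma lam_mul_lintegral_fadingLoss [IsProbabilityMeasure P] (hN : N.IsModel P) (m : Fin M) (k : ℕ)
    {β z : ℝ} (hβ : 0 ≤ β) (hz : 0 ≤ z) :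
    ENNReal.ofReal N.lam * (P {ω | N.label k ω = m} *
        ∫⁻ x : Plane, N.fadingLoss P k (β * z) ‖x‖)
      = ENNReal.ofReal (N.theta P m k β * z ^ (2 / N.α)) := by
  have hC := pi_div_sinc_pos hN
  set C := Real.pi / Real.sinc (Real.pi * (2 / N.α)) with hCdef
  have h1 : ∫⁻ ω, ENNReal.ofReal ((β * z * N.power k ω) ^ (2 / N.α) * C) ∂P
      = ENNReal.ofReal (β ^ (2 / N.α) * z ^ (2 / N.α) * C *
        ∫ ω, N.power k ω ^ (2 / N.α) ∂P) := by
    rw [← integral_const_mul, ofReal_integral_eq_lintegral_ofReal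
      ((hN.power_moment k).const_mul _)]
    · refine lintegral_congr_ae ?_
      filter_upwards [hN.power_pos k] with ω hω
      rw [Real.mul_rpow (mul_nonneg hβ hz) hω.le, Real.mul_rpow hβ hz]
      congr 1
      ring
    · filter_upwards [hN.power_pos k] with ω hω
      simp only [Pi.zero_apply]
      positivity
  rw [lintegral_fadingLoss hN k (mul_nonneg hβ hz), h1,
    ← ENNReal.ofReal_toReal (measure_ne_top P {ω | N.label k ω = m}),
    ← ENNReal.ofReal_mul ENNReal.toReal_nonneg, ← ENNReal.ofReal_mul hN.lam_pos.le, theta]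
  congr 1
  simp only [hCdef, Measure.real]
  ring

/-! ### Coverage -/

lemma coverage_eq_lintegral [IsProbabilityMeasure P] (hN : N.IsModel P) (m : Fin M)
    (hq : ∀ k, P {ω | N.label k ω = m} ≠ 0) (k : ℕ) {β : ℝ} (hβ : 0 < β) :
    N.coverage P m β = ∫⁻ ω,
      expNeg (ENNReal.ofReal (β * N.Z k ω) * ENNReal.ofReal (N.σ ^ 2)) *
      expNeg (ENNReal.ofReal N.lam * (P {ω | N.label k ω = m} *
        ∫⁻ z : Plane, N.fadingLoss P k (β * N.Z k ω) ‖z‖)) *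
      ((volume N.cell)⁻¹ * ∫⁻ y in N.cell, N.cueTransform P m y (β * N.Z k ω)) ∂P := by
  have hmeas : ∀ j, Measurable fun ω => ∫⁻ ω', N.linkKernel P m k β j
      (N.offset k ω, N.power k ω) (fun i => N.tx i ω') ∂P := by
    intro j
    have hz : Measurable fun z : Ω × Ω => ((N.offset k z.1, N.power k z.1), fun i => N.tx i z.2) :=
      ((((hN.measurable_offset k).prodMk (hN.measurable_power k)).comp measurable_fst)).prodMk
        (measurable_pi_lambda _ fun i => (hN.measurable_tx i).comp measurable_snd)
    have h := ((measurable_linkKernel hN m k β j).comp hz).lintegral_prod_right' (ν := P)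
    exact h
  have hA : ENNReal.ofReal N.lam * P {ω | N.label k ω = m} ≠ 0 :=
    mul_ne_zero (ENNReal.ofReal_pos.2 hN.lam_pos).ne' (hq k)
  have hA' : ENNReal.ofReal N.lam * P {ω | N.label k ω = m} ≠ ∞ :=
    ENNReal.mul_ne_top ENNReal.ofReal_ne_top (measure_ne_top P _)
  rw [coverage, meanLinks_eq hN m k]
  simp_rw [measure_covered_eq_lintegral_linkKernel hN m k _ hβ]
  rw [← lintegral_tsum fun j => (hmeas j).aemeasurable]
  simp_rw [tsum_lintegral_linkKernel hN, laplaceArg_mark]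
  -- The factor `λ q` cancels against `meanLinks`, and the remaining `|cell|⁻¹` normalises the
  -- receiver average.
  rw [lintegral_const_mul' _ _ hA', ENNReal.mul_div_mul_left _ _ hA hA', div_eq_mul_inv,
    ← lintegral_mul_const' _ _ (ENNReal.inv_ne_top.2 (volume_cell_ne_zero hN))]
  exact lintegral_congr fun ω => by ring

lemma coverage_eq [IsProbabilityMeasure P] (hN : N.IsModel P) (m : Fin M)
    (hq : ∀ k, P {ω | N.label k ω = m} ≠ 0) (k : ℕ) {β : ℝ} (hβ : 0 < β) :
    N.coverage P m β = ENNReal.ofReal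
      (∫ ω, Real.exp (-(β * N.σ ^ 2 * N.Z k ω) - N.theta P m k β * N.Z k ω ^ (2 / N.α)) *
        N.laplaceY P m k (β * N.Z k ω) ∂P) := by
  have hZ := measurable_Z hN k
  have hI : Measurable fun ω => ∫⁻ y in N.cell, N.cueTransform P m y (β * N.Z k ω) := by
    have h : Measurable fun z : Ω × Plane => N.cueTransform P m z.2 (β * N.Z k z.1) :=
      measurable_comp_cueTransform hN m measurable_snd ((hZ.comp measurable_fst).const_mul β)
    exact h.lintegral_prod_right' (ν := volume.restrict N.cell)
  let J : Ω → ℝ≥0∞ := fun ω =>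
    expNeg (ENNReal.ofReal (β * N.σ ^ 2 * N.Z k ω)) *
    expNeg (ENNReal.ofReal (N.theta P m k β * N.Z k ω ^ (2 / N.α))) *
    ((volume N.cell)⁻¹ * ∫⁻ y in N.cell, N.cueTransform P m y (β * N.Z k ω))
  have hJ : Measurable J := by fun_prop
  have hJtop : ∀ ω, J ω ≠ ∞ := fun ω =>
    ENNReal.mul_ne_top (ENNReal.mul_ne_top (expNeg_ne_top _) (expNeg_ne_top _))
      (ENNReal.mul_ne_top (ENNReal.inv_ne_top.2 (volume_cell_ne_zero hN))
        (lintegral_cueTransform_ne_top m _))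
  have h1 : N.coverage P m β = ∫⁻ ω, J ω ∂P := by
    rw [coverage_eq_lintegral hN m hq k hβ]
    refine lintegral_congr_ae ?_
    filter_upwards [ae_Z_nonneg hN k] with ω hω
    simp only [J]
    rw [lam_mul_lintegral_fadingLoss hN m k hβ.le hω, ← ENNReal.ofReal_mul (by positivity)]
    congr 4
    ring
  have h2 : ∫ ω, Real.exp (-(β * N.σ ^ 2 * N.Z k ω) -
      N.theta P m k β * N.Z k ω ^ (2 / N.α)) * N.laplaceY P m k (β * N.Z k ω) ∂P
      = ∫ ω, (J ω).toReal ∂P := by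
    refine integral_congr_ae ?_
    filter_upwards [ae_Z_nonneg hN k] with ω hω
    have hθ := theta_nonneg hN m k hβ.le
    simp only [J]
    rw [expNeg_ofReal (by positivity), expNeg_ofReal (by positivity), ENNReal.toReal_mul,
      ENNReal.toReal_mul, ← laplaceY_eq hN m k (by positivity),
      ENNReal.toReal_ofReal (Real.exp_pos _).le, ENNReal.toReal_ofReal (Real.exp_pos _).le,
      ← Real.exp_add, ← sub_eq_add_neg]
  -- The numerator of the coverage is at most `meanLinks`, hence finite.
  have hle : ∫⁻ ω, J ω ∂P ≠ ∞ := by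
    rw [← h1]
    refine ENNReal.div_ne_top ?_ (meanLinks_ne_zero hN m hq)
    exact ne_top_of_le_ne_top (meanLinks_ne_top hN m)
      (ENNReal.tsum_le_tsum fun j => measure_mono Set.inter_subset_left)
  rw [h1, h2, integral_toReal hJ.aemeasurable (ae_of_all _ fun ω => (hJtop ω).lt_top),
    ENNReal.ofReal_toReal hle]

/-! ### The distribution of `Z` -/

lemma Z_le_iff (hN : N.IsModel P) {d p z : ℝ} (hd : 0 ≤ d) (hp : 0 < p) (hz : 0 ≤ z) :
    d ^ N.α / p ≤ z ↔ d ≤ z ^ (1 / N.α) * p ^ (1 / N.α) := by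
  have hα : 0 < N.α := two_pos.trans hN.two_lt_α
  rw [div_le_iff₀ hp, ← Real.mul_rpow hz hp.le, one_div,
    Real.le_rpow_inv_iff_of_pos hd (mul_nonneg hz hp.le) hα]

lemma cdf_Z [IsProbabilityMeasure P] (hN : N.IsModel P) (k : ℕ)
    (hind : IndepFun (N.linkDist k) (N.power k) P) {z : ℝ} (hz : 0 ≤ z) :
    cdf (P.map (N.Z k)) z =
      ∫ p, cdf (P.map (N.linkDist k)) (z ^ (1 / N.α) * p ^ (1 / N.α)) ∂(P.map (N.power k)) := by
  have hd := measurable_linkDist hN k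
  have hp := hN.measurable_power k
  have hZ := measurable_Z hN k
  have := Measure.isProbabilityMeasure_map (μ := P) hd.aemeasurable
  have := Measure.isProbabilityMeasure_map (μ := P) hZ.aemeasurable
  have hcm : Measurable fun p : ℝ => cdf (P.map (N.linkDist k)) (z ^ (1 / N.α) * p ^ (1 / N.α)) :=
    (monotone_cdf _).measurable.comp (by fun_prop)
  have hS : MeasurableSet {q : ℝ × ℝ | q.2 ^ N.α / q.1 ≤ z} :=
    measurableSet_le (by fun_prop) measurable_const
  have h1 := lintegral_comp_of_indepFun
    (G := fun p d => {q : ℝ × ℝ | q.2 ^ N.α / q.1 ≤ z}.indicator (1 : ℝ × ℝ → ℝ≥0∞) (p, d))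
    hp hd hind.symm (measurable_one.indicator hS)
  have h2 : ∫⁻ ω, {q : ℝ × ℝ | q.2 ^ N.α / q.1 ≤ z}.indicator (1 : ℝ × ℝ → ℝ≥0∞)
      (N.power k ω, N.linkDist k ω) ∂P = P.map (N.Z k) (Set.Iic z) := by
    rw [Measure.map_apply hZ measurableSet_Iic, ← lintegral_indicator_one (hZ measurableSet_Iic)]
    rfl
  have h3 : ∀ᵐ ω ∂P, ∫⁻ ω', {q : ℝ × ℝ | q.2 ^ N.α / q.1 ≤ z}.indicator (1 : ℝ × ℝ → ℝ≥0∞)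
      (N.power k ω, N.linkDist k ω') ∂P
      = ENNReal.ofReal (cdf (P.map (N.linkDist k)) (z ^ (1 / N.α) * N.power k ω ^ (1 / N.α))) := by
    -- For a frozen positive power, `Z ≤ z` is a bound on the link distance alone; independence lets
    -- that distance be averaged separately.
    filter_upwards [hN.power_pos k] with ω hω
    rw [ofReal_cdf, Measure.map_apply hd measurableSet_Iic,
      ← lintegral_indicator_one (hd measurableSet_Iic)]
    refine lintegral_congr fun ω' => ?_
    have h := Z_le_iff hN (linkDist_nonneg (N := N) k ω') hω hz
    by_cases h' : N.linkDist k ω' ^ N.α / N.power k ω ≤ z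
    · rw [Set.indicator_of_mem (by exact h'), Set.indicator_of_mem (by exact h.1 h')]
      rfl
    · rw [Set.indicator_of_notMem (by exact h'),
        Set.indicator_of_notMem (by exact fun hc => h' (h.2 hc))]
  rw [h2, lintegral_congr_ae h3] at h1
  rw [integral_map hp.aemeasurable hcm.aestronglyMeasurable, cdf_eq_real, Measure.real, h1,
    integral_eq_lintegral_of_nonneg_ae (ae_of_all _ fun ω => cdf_nonneg _ _)
      (hcm.comp hp).aestronglyMeasurable]

end D2DNetwork
theorem proposition2 {Ω : Type*} [MeasurableSpace Ω] (P : Measure Ω) [IsProbabilityMeasure P]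
    {M : ℕ} (N : D2DNetwork Ω M) (hN : N.IsModel P) (m : Fin M)
    (hq : ∀ k, P {ω | N.label k ω = m} ≠ 0) (β : ℝ) (hβ : 0 < β) :
    (N.meanLinks P m ≠ 0 ∧ N.meanLinks P m ≠ ∞) ∧
    ∀ k : ℕ,
      N.coverage P m β = ENNReal.ofReal
        (∫ ω, Real.exp (-(β * N.σ ^ 2 * N.Z k ω) - N.theta P m k β * N.Z k ω ^ (2 / N.α)) *
          N.laplaceY P m k (β * N.Z k ω) ∂P) ∧
      (IndepFun (N.linkDist k) (N.power k) P → ∀ z : ℝ, 0 ≤ z →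
        cdf (P.map (N.Z k)) z =
          ∫ p, cdf (P.map (N.linkDist k)) (z ^ (1 / N.α) * p ^ (1 / N.α)) ∂(P.map (N.power k))) :=
  ⟨⟨D2DNetwork.meanLinks_ne_zero hN m hq, D2DNetwork.meanLinks_ne_top hN m⟩, fun k =>
    ⟨D2DNetwork.coverage_eq hN m hq k hβ, fun hind _ hz => D2DNetwork.cdf_Z hN k hind hz⟩⟩
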